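/- Let $\mathcal A$ be a complex Banach algebra (with $\|ab\|\le\|a\|\|b\|$, not necessarily unital), and let $\mathcal A_*$ be a Banach space together with an isometric isomorphism $\mathcal A\cong(\mathcal A_*)'$ for which the product of $\mathcal A$ is separately weak$^*$-continuous; that is, $(\mathcal A,\mathcal A_*)$ is a dual Banach algebra. Regard $\mathcal A_*$ as a subspace of $\mathcal A'$, and for $\mu\in\mathcal A'$, $a\in\mathcal A$ let $a\cdot\mu\in\mathcal A'$ be given by $\langle a\cdot\mu,b\rangle=\langle\mu,ba\rangle$. (1) Suppose that $\mathcal A$ has a unit. Then each $\mu\in\mathcal A_*$ with $\|\mu\|=1$ has an admissible norm, that is, a norm $\|\cdot\|_\mu$ on $\mathcal A\cdot\mu=\{a\cdot\mu : a\in\mathcal A\}$ such that $$\|ab\cdot\mu\|_\mu\le\|a\|\,\|b\cdot\mu\|_\mu,\qquad \|a\cdot\mu\|\le\|a\cdot\mu\|_\mu\le\|a\|\,\|\mu\|\qquad(a,b\in\mathcal A),$$ the completion $E_\mu$ of $(\mathcal A\cdot\mu,\|\cdot\|_\mu)$ is reflexive, and the continuous extension $\iota:E_\mu\to\mathcal A'$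 of the inclusion map (which takes values in $\mathcal A_*$) is injective. (2) There are a reflexive Banach space $E$ and an algebra homomorphism $\pi:\mathcal A\to\mathcal B(E)$ such that $\pi$ is isometric, $\pi$ is continuous from the weak$^*$-topology of $\mathcal A=(\mathcal A_*)'$ to the weak$^*$-topology of $\mathcal B(E)$, and the image $\pi(\mathcal A)$ is a weak$^*$-closed subalgebra of $\mathcal B(E)$. Here the weak$^*$-topology of $\mathcal B(E)$ is that given by its canonical predual, the projective tensor product $E'\widehat\otimes E$, through the pairing $\langle T,f\otimes x\rangle=f(Tx)$. -/

import Mathlib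

universe u v

open scoped TensorProduct

noncomputable section

namespace DualBanach

/-! ### Reflexive spaces -/

/-- A complex normed space is reflexive if the canonical map into its bidual is onto. -/
def IsReflexive (E : Type*) [NormedAddCommGroup E] [NormedSpace ℂ E] : Prop :=
  Function.Surjective (NormedSpace.inclusionInDoubleDual ℂ E)

/-! ### The weak-star topology given by a duality -/

/-- The weak-star topology on `X` coming from a map `Φ` of `X` into the dual of `P`: the topology of
pointwise convergence of `Φ x` on `P`. -/
@[reducible]
def weakStar {X P : Type*} [NormedAddCommGroup P] [NormedSpace ℂ P]
    (Φ : X → StrongDual ℂ P) : TopologicalSpace X :=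
  TopologicalSpace.induced (fun x => StrongDual.toWeakDual (Φ x))
    (inferInstance : TopologicalSpace (WeakDual ℂ P))

/-! ### Dual Banach algebras -/

/-- A dual Banach algebra structure with predual `P` on the Banach algebra `A`: an isometric
identification of `A` with the dual of `P` for which the product is separately
weak-star continuous. -/
structure DualBanachAlgebra (A P : Type*) [NonUnitalNormedRing A] [NormedSpace ℂ A]
    [NormedAddCommGroup P] [NormedSpace ℂ P] where
  /-- the identification of the algebra with the dual of the predual -/
  toDual : A ≃ₗᵢ[ℂ] StrongDual ℂ P
  continuous_mul_left : ∀ a : A,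
    @Continuous A A (weakStar toDual) (weakStar toDual) (fun b => a * b)
  continuous_mul_right : ∀ a : A,
    @Continuous A A (weakStar toDual) (weakStar toDual) (fun b => b * a)

/-- The weak-star topology of a dual Banach algebra. -/
@[reducible]
def DualBanachAlgebra.topology {A P : Type*} [NonUnitalNormedRing A] [NormedSpace ℂ A]
    [NormedAddCommGroup P] [NormedSpace ℂ P] (D : DualBanachAlgebra A P) : TopologicalSpace A :=
  weakStar D.toDual

/-- The canonical embedding of the predual into the dual of the algebra, `⟨μ, a⟩ = ⟨a, μ⟩`. -/
def DualBanachAlgebra.embed {A P : Type*} [NonUnitalNormedRing A] [NormedSpace ℂ A]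
    [NormedAddCommGroup P] [NormedSpace ℂ P] (D : DualBanachAlgebra A P) :
    P →L[ℂ] StrongDual ℂ A :=
  (D.toDual.toContinuousLinearEquiv : A →L[ℂ] StrongDual ℂ P).flip

/-! ### Admissible norms -/

section Admissible

variable {A : Type*} [NonUnitalNormedRing A] [NormedSpace ℂ A] [IsScalarTower ℂ A A]
  [SMulCommClass ℂ A A]

/-- The map `a ↦ a · μ` from `A` to its dual, where `⟨a · μ, b⟩ = ⟨μ, b a⟩`. -/
def act (μ : StrongDual ℂ A) : A →L[ℂ] StrongDual ℂ A :=
  (ContinuousLinearMap.compL ℂ A A ℂ μ).comp (ContinuousLinearMap.mul ℂ A).flip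

theorem act_apply (μ : StrongDual ℂ A) (a b : A) : act μ a b = μ (b * a) := rfl

/-- The subspace `A · μ = {a · μ : a ∈ A}` of the dual of `A`. -/
def orbit (μ : StrongDual ℂ A) : Submodule ℂ (StrongDual ℂ A) :=
  LinearMap.range (act μ : A →ₗ[ℂ] StrongDual ℂ A)

/-- The element `a · μ` of `A · μ`. -/
def toOrbit (μ : StrongDual ℂ A) (a : A) : orbit μ := ⟨act μ a, a, rfl⟩

end Admissible

/-- `N` is an admissible norm for `μ`.  (The lower bound in `norm_le` makes the seminorm `N` a
norm.)  The space `F` with the dense isometric map `j` is the completion of `(A · μ, N)`, unique up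
to isometric isomorphism, and `ι` is the continuous extension to it of the inclusion of `A · μ`. -/
structure IsAdmissibleNorm {A : Type u} [NonUnitalNormedRing A] [NormedSpace ℂ A]
    [IsScalarTower ℂ A A] [SMulCommClass ℂ A A] (μ : StrongDual ℂ A)
    (N : Seminorm ℂ (orbit μ)) : Prop where
  mul_le : ∀ a b : A, N (toOrbit μ (a * b)) ≤ ‖a‖ * N (toOrbit μ b)
  norm_le : ∀ a : A, ‖act μ a‖ ≤ N (toOrbit μ a)
  le_norm : ∀ a : A, N (toOrbit μ a) ≤ ‖a‖ * ‖μ‖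
  completion : ∃ (F : Type u) (_ : NormedAddCommGroup F) (_ : NormedSpace ℂ F)
    (_ : CompleteSpace F) (j : orbit μ →ₗ[ℂ] F) (ι : F →L[ℂ] StrongDual ℂ A),
    (∀ x, ‖j x‖ = N x) ∧ DenseRange j ∧ (∀ x, ι (j x) = x) ∧
    IsReflexive F ∧ Function.Injective ι


/-! ### The projective tensor product -/

section Projective

variable (X Y : Type*) [NormedAddCommGroup X] [NormedSpace ℂ X]
  [NormedAddCommGroup Y] [NormedSpace ℂ Y]

/-- The algebraic tensor product, to be equipped with the projective norm. -/
def AlgTensor : Type _ := X ⊗[ℂ] Y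

instance : AddCommGroup (AlgTensor X Y) := inferInstanceAs (AddCommGroup (X ⊗[ℂ] Y))

instance : Module ℂ (AlgTensor X Y) := inferInstanceAs (Module ℂ (X ⊗[ℂ] Y))

variable {X Y}

/-- The elementary tensor `x ⊗ y`. -/
def AlgTensor.tmul (x : X) (y : Y) : AlgTensor X Y := x ⊗ₜ[ℂ] y

/-- The sums `∑ ‖x k‖ ‖y k‖` over all the ways of writing `τ` as `∑ x k ⊗ y k`. -/
def projSums (τ : AlgTensor X Y) : Set ℝ :=
  {r | ∃ (n : ℕ) (x : Fin n → X) (y : Fin n → Y),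
    τ = ∑ k, AlgTensor.tmul (x k) (y k) ∧ r = ∑ k, ‖x k‖ * ‖y k‖}

theorem projSums_nonneg {τ : AlgTensor X Y} {r : ℝ} (h : r ∈ projSums τ) : 0 ≤ r := by
  obtain ⟨n, x, y, -, rfl⟩ := h
  positivity

theorem projSums_bddBelow (τ : AlgTensor X Y) : BddBelow (projSums τ) :=
  ⟨0, fun _ h => projSums_nonneg h⟩

theorem projSums_zero : (0 : ℝ) ∈ projSums (0 : AlgTensor X Y) :=
  ⟨0, Fin.elim0, Fin.elim0, by simp, by simp⟩

theorem projSums_add {σ τ : AlgTensor X Y} {r s : ℝ} (hr : r ∈ projSums σ)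
    (hs : s ∈ projSums τ) : r + s ∈ projSums (σ + τ) := by
  obtain ⟨m, x, y, rfl, rfl⟩ := hr
  obtain ⟨n, z, w, rfl, rfl⟩ := hs
  exact ⟨m + n, Fin.append x z, Fin.append y w, by simp [Fin.sum_univ_add],
    by simp [Fin.sum_univ_add]⟩

theorem projSums_smul (c : ℂ) {τ : AlgTensor X Y} {r : ℝ} (hr : r ∈ projSums τ) :
    ‖c‖ * r ∈ projSums (c • τ) := by
  obtain ⟨n, x, y, rfl, rfl⟩ := hr
  refine ⟨n, fun k => c • x k, y, ?_, ?_⟩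
  · rw [Finset.smul_sum]
    exact Finset.sum_congr rfl fun k _ => (TensorProduct.smul_tmul' c (x k) (y k))
  · rw [Finset.mul_sum]
    exact Finset.sum_congr rfl fun k _ => by rw [norm_smul, mul_assoc]

theorem projSums_nonempty (τ : AlgTensor X Y) : (projSums τ).Nonempty := by
  refine TensorProduct.induction_on (motive := fun τ => (projSums (X := X) (Y := Y) τ).Nonempty) τ
    ⟨0, projSums_zero⟩ ?_ ?_
  · intro x y
    exact ⟨‖x‖ * ‖y‖, 1, fun _ => x, fun _ => y, by
      rw [Fin.sum_univ_one]; rfl, by simp⟩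
  · rintro σ τ ⟨r, hr⟩ ⟨s, hs⟩
    exact ⟨r + s, projSums_add hr hs⟩

/-- The projective norm, the infimum of `∑ ‖x k‖ ‖y k‖` over the representations
`τ = ∑ x k ⊗ y k`. -/
def projNorm : Seminorm ℂ (AlgTensor X Y) :=
  Seminorm.ofSMulLE (fun τ => sInf (projSums τ))
    (le_antisymm (csInf_le (projSums_bddBelow _) projSums_zero)
      (le_csInf (projSums_nonempty _) fun _ h => projSums_nonneg h))
    (fun σ τ => by
      rw [← csInf_add (projSums_nonempty σ) (projSums_bddBelow σ) (projSums_nonempty τ)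
        (projSums_bddBelow τ)]
      refine csInf_le_csInf (projSums_bddBelow _)
        ((projSums_nonempty σ).add (projSums_nonempty τ)) ?_
      rintro _ ⟨r, hr, s, hs, rfl⟩
      exact projSums_add hr hs)
    (fun c τ => by
      change sInf (projSums (c • τ)) ≤ ‖c‖ • sInf (projSums τ)
      rw [← Real.sInf_smul_of_nonneg (norm_nonneg c)]
      refine csInf_le_csInf (projSums_bddBelow _) (projSums_nonempty τ).smul_set ?_
      rintro _ ⟨r, hr, rfl⟩
      exact projSums_smul c hr)

instance : SeminormedAddCommGroup (AlgTensor X Y) :=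
  AddGroupSeminorm.toSeminormedAddCommGroup (projNorm (X := X) (Y := Y)).toAddGroupSeminorm

instance : NormedSpace ℂ (AlgTensor X Y) where
  norm_smul_le c τ := (map_smul_eq_mul (projNorm (X := X) (Y := Y)) c τ).le

theorem norm_eq_sInf (τ : AlgTensor X Y) : ‖τ‖ = sInf (projSums τ) := rfl

variable (X Y) in
/-- The projective tensor product: the completion of the algebraic tensor product in the
projective norm. -/
abbrev ProjTensor : Type _ := UniformSpace.Completion (AlgTensor X Y)

end Projective

/-! ### The weak-star topology on the bounded operators -/

section Operators

variable (E : Type*) [NormedAddCommGroup E] [NormedSpace ℂ E]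

variable {E} in
/-- The functional on the algebraic tensor product of `E'` and `E` given by
`f ⊗ x ↦ f (T x)`. -/
def algPairing (T : E →L[ℂ] E) : AlgTensor (StrongDual ℂ E) E →ₗ[ℂ] ℂ :=
  TensorProduct.lift (LinearMap.mk₂ ℂ (fun (f : StrongDual ℂ E) (x : E) => f (T x))
    (by simp) (by simp) (by simp) (by simp))

variable {E} in
theorem algPairing_tmul (T : E →L[ℂ] E) (f : StrongDual ℂ E) (x : E) :
    algPairing T (AlgTensor.tmul f x) = f (T x) := rfl

variable {E} in
theorem norm_algPairing_le (T : E →L[ℂ] E) (τ : AlgTensor (StrongDual ℂ E) E) :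
    ‖algPairing T τ‖ ≤ ‖T‖ * ‖τ‖ := by
  rw [norm_eq_sInf, ← smul_eq_mul, ← Real.sInf_smul_of_nonneg (norm_nonneg T)]
  refine le_csInf (projSums_nonempty τ).smul_set ?_
  rintro _ ⟨_, ⟨n, f, x, rfl, rfl⟩, rfl⟩
  simp only [map_sum, algPairing_tmul, smul_eq_mul, Finset.mul_sum]
  refine norm_sum_le_of_le _ fun k _ => ?_
  calc ‖f k (T (x k))‖ ≤ ‖f k‖ * (‖T‖ * ‖x k‖) :=
        (f k).le_opNorm_of_le (T.le_opNorm _)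
    _ = ‖T‖ * (‖f k‖ * ‖x k‖) := by ring

/-- The canonical duality between the bounded operators on `E` and the projective tensor product of
`E'` and `E`, determined by `⟨T, f ⊗ x⟩ = f (T x)` and continuity. -/
def operatorPairing (T : E →L[ℂ] E) : StrongDual ℂ (ProjTensor (StrongDual ℂ E) E) :=
  ((algPairing T).mkContinuous ‖T‖ (norm_algPairing_le T)).extend
    (UniformSpace.Completion.toComplL (𝕜 := ℂ) (E := AlgTensor (StrongDual ℂ E) E))

theorem operatorPairing_coe (T : E →L[ℂ] E) (τ : AlgTensor (StrongDual ℂ E) E) :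
    operatorPairing E T (τ : ProjTensor (StrongDual ℂ E) E) = algPairing T τ :=
  ContinuousLinearMap.extend_eq _ (UniformSpace.Completion.denseRange_coe)
    (UniformSpace.Completion.isUniformInducing_coe _) τ

/-- The weak-star topology on the bounded operators on `E` induced by the projective tensor product
of `E'` and `E` (for reflexive `E`, its canonical predual). -/
@[reducible]
def operatorTopology : TopologicalSpace (E →L[ℂ] E) :=
  weakStar (operatorPairing E)

end Operators

end DualBanach

end

noncomputable section

namespace DualBanach

open scoped ENNReal Topology

/-! ### Separation of points from closed subspaces -/

section Separation

variable {E : Type*} [NormedAddCommGroup E] [NormedSpace ℂ E]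

/-! Fix φ in the predual and put T a = a · φ, from A to A'. A functional ξ on A' restricts to the
predual as evaluation at some b in A, because A is the whole dual of the predual. One-sided
weak-star continuity keeps a · φ in the predual, so ξ ∘ T = φ(b ·), which by continuity on the other
side is again in the predual. Hence the second adjoint of T maps A'' into A', that is, T is weakly
compact (`DualBanachAlgebra.isWeaklyCompact_act`).

A weakly compact T : Z → X factors through a reflexive space by the Davis–Figiel–Johnson–Pełczyński
construction: renorm X by the gauges of s_n T(B) + t_n B' with t_n → 0, and close the diagonal in
the square sum of these spaces (`IsWeaklyCompact.exists_isInterpolationSpace`). The weights make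
both factors contractive, and since the construction is natural, each pair of operators intertwined
by T lifts with no loss of norm. Lifting left multiplication on A and the module action on A' gives
the admissible norm.

For the representation, the factorization is applied to the action of the unitization on the
functional extending φ by 0 at the adjoined unit. On the resulting space φ is a coefficient f(ρ(a)x)
with f and x in the unit balls, and all coefficients lie in the predual. The square sum over the
unit ball of the predual is a reflexive space E with a contractive π, and every q in the predual is
a coefficient of π with norm control. So the map from the projective tensor product of E' and E to
A' that is pre-adjoint to π takes values in the predual, reaches all of it on elementary tensors,
and does so without loss of norm. This gives the isometry, the weak-star continuity, and the
identification of the range with the annihilator of the kernel of that map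
(`DualBanachAlgebra.isometry_continuous_isClosed_range`). -/

/-- A point at which every functional vanishing on a closed subspace vanishes lies in it. -/
theorem mem_of_forall_dual_eq_zero {S : Submodule ℂ E} (hS : IsClosed (S : Set E)) {x : E}
    (h : ∀ f : StrongDual ℂ E, (∀ y ∈ S, f y = 0) → f x = 0) : x ∈ S := by
  have := hS
  rw [← Submodule.Quotient.mk_eq_zero S]
  refine SeparatingDual.eq_zero_of_forall_dual_eq_zero (R := ℂ) fun f => ?_
  refine h (f.comp (S.mkQ.mkContinuous 1 fun y => ?_)) fun y hy => ?_
  · simpa using Submodule.Quotient.norm_mk_le S y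
  · have : S.mkQ y = 0 := by simpa using hy
    change f (S.mkQ y) = 0
    rw [this, map_zero]

/-- If `ι` is injective on a reflexive space, a bounded operator on its dual that maps the
functionals `ξ ∘ ι` into a closed subspace maps all functionals into it. -/
theorem IsReflexive.apply_mem_of_comp_mem {F X Y : Type*} [NormedAddCommGroup F] [NormedSpace ℂ F]
    [NormedAddCommGroup X] [NormedSpace ℂ X] [NormedAddCommGroup Y] [NormedSpace ℂ Y]
    (hF : IsReflexive F) {ι : F →L[ℂ] X} (hι : Function.Injective ι) {S : Submodule ℂ Y}
    (hS : IsClosed (S : Set Y)) (B : StrongDual ℂ F →L[ℂ] Y)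
    (h : ∀ ξ : StrongDual ℂ X, B (ξ.comp ι) ∈ S) (f : StrongDual ℂ F) : B f ∈ S := by
  -- If L vanishes on S, then L ∘ B is evaluation at some y by reflexivity. Every ξ kills ι y, so y
  -- = 0 by injectivity, and L ∘ B = 0.
  refine mem_of_forall_dual_eq_zero hS fun L hL => ?_
  obtain ⟨y, hy⟩ := hF (L.comp B)
  have hy' : ∀ g : StrongDual ℂ F, L (B g) = g y := fun g =>
    (congrArg (fun Φ : StrongDual ℂ (StrongDual ℂ F) => Φ g) hy).symm
  have : ι y = 0 := SeparatingDual.eq_zero_of_forall_dual_eq_zero (R := ℂ) fun ξ => by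
    have := hy' (ξ.comp ι)
    rw [hL _ (h ξ)] at this
    exact this.symm
  rw [hy' f, hι (this.trans (map_zero ι).symm), map_zero]

end Separation

/-! ### Square-summable families -/

section SquareSum

variable {I : Type*} {G : I → Type*} [∀ i, NormedAddCommGroup (G i)]

/-- The square of the norm of a square-summable family is the sum of the squares. -/
theorem hasSum_norm_sq (f : lp G 2) : HasSum (fun i => ‖f i‖ ^ 2) (‖f‖ ^ 2) := by
  simpa using lp.hasSum_norm (by simp) f

theorem memℓp_two_of_sum_le {f : ∀ i, G i} {C : ℝ} (h : ∀ s : Finset I, ∑ i ∈ s, ‖f i‖ ^ 2 ≤ C) :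
    Memℓp f 2 :=
  memℓp_gen' (C := C) (by simpa using h)

theorem norm_le_of_sum_sq_le {f : lp G 2} {C : ℝ} (hC : 0 ≤ C)
    (h : ∀ s : Finset I, ∑ i ∈ s, ‖f i‖ ^ 2 ≤ C ^ 2) : ‖f‖ ≤ C :=
  lp.norm_le_of_forall_sum_le (by simp) hC (by simpa using h)

variable [∀ i, NormedSpace ℂ (G i)]

theorem sum_norm_apply_sq_le {C : ℝ} (T : ∀ i, G i →L[ℂ] G i) (hT : ∀ i, ‖T i‖ ≤ C)
    (f : lp G 2) (s : Finset I) : ∑ i ∈ s, ‖T i (f i)‖ ^ 2 ≤ (C * ‖f‖) ^ 2 := by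
  have hfs := sum_le_hasSum s (fun i _ => sq_nonneg _) (hasSum_norm_sq f)
  calc ∑ i ∈ s, ‖T i (f i)‖ ^ 2 ≤ ∑ i ∈ s, C ^ 2 * ‖f i‖ ^ 2 :=
        Finset.sum_le_sum fun i _ => by
          rw [← mul_pow]
          exact pow_le_pow_left₀ (norm_nonneg _) ((T i).le_of_opNorm_le (hT i) _) 2
    _ = C ^ 2 * ∑ i ∈ s, ‖f i‖ ^ 2 := by rw [Finset.mul_sum]
    _ ≤ C ^ 2 * ‖f‖ ^ 2 := mul_le_mul_of_nonneg_left hfs (sq_nonneg _)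
    _ = (C * ‖f‖) ^ 2 := by rw [mul_pow]

/-- The operator on square-summable families acting in each coordinate by a given operator, for a
family of operators bounded by `C`. -/
def diagOp {C : ℝ} (hC : 0 ≤ C) (T : ∀ i, G i →L[ℂ] G i) (hT : ∀ i, ‖T i‖ ≤ C) :
    lp G 2 →L[ℂ] lp G 2 :=
  LinearMap.mkContinuous
    { toFun := fun f =>
        ⟨fun i => T i (f i), memℓp_two_of_sum_le (sum_norm_apply_sq_le T hT f)⟩
      map_add' := fun f g => by ext i; exact map_add (T i) (f i) (g i)
      map_smul' := fun c f => by ext i; exact map_smul (T i) c (f i) }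
    C fun f => norm_le_of_sum_sq_le (by positivity) (sum_norm_apply_sq_le T hT f)

@[simp]
theorem diagOp_apply {C : ℝ} (hC : 0 ≤ C) (T : ∀ i, G i →L[ℂ] G i) (hT : ∀ i, ‖T i‖ ≤ C)
    (f : lp G 2) (i : I) : diagOp hC T hT f i = T i (f i) := rfl

theorem norm_diagOp_le {C : ℝ} (hC : 0 ≤ C) (T : ∀ i, G i →L[ℂ] G i) (hT : ∀ i, ‖T i‖ ≤ C) :
    ‖diagOp hC T hT‖ ≤ C :=
  LinearMap.mkContinuous_norm_le _ hC _

section Truncation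

variable [DecidableEq I]

variable (G) in
/-- The truncation of a square-summable family to a finite set of indices. -/
def truncate (s : Finset I) : lp G 2 →L[ℂ] lp G 2 :=
  ∑ i ∈ s, (lp.singleContinuousLinearMap ℂ G 2 i).comp (lp.evalCLM ℂ G 2 i)

theorem truncate_apply (s : Finset I) (f : lp G 2) :
    truncate G s f = ∑ i ∈ s, lp.single 2 i (f i) := by
  simp [truncate]
  rfl

theorem truncate_apply_apply (s : Finset I) (f : lp G 2) (j : I) :
    truncate G s f j = if j ∈ s then f j else 0 := by
  rw [truncate_apply, lp.coeFn_sum, Finset.sum_apply]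
  simp only [lp.coeFn_single]
  split_ifs with h
  · rw [Finset.sum_eq_single j]
    · simp
    · intro i _ hi; simp [hi.symm]
    · exact fun h' => absurd h h'
  · refine Finset.sum_eq_zero fun i hi => ?_
    have : j ≠ i := fun e => h (e ▸ hi)
    simp [this]

theorem truncate_truncate (s : Finset I) (f : lp G 2) :
    truncate G s (truncate G s f) = truncate G s f := by
  ext j
  simp only [truncate_apply_apply]
  split_ifs <;> rfl

theorem norm_sq_eq_truncate_add (s : Finset I) (f : lp G 2) :
    ‖f‖ ^ 2 = ‖truncate G s f‖ ^ 2 + ‖f - truncate G s f‖ ^ 2 := by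
  have h1 := lp.norm_sum_single (p := 2) (by simp) (f : ∀ i, G i) s
  have h2 := lp.norm_compl_sum_single (p := 2) (by simp) f s
  rw [truncate_apply]
  norm_num at h1 h2 ⊢
  rw [h1, h2]
  ring

theorem norm_truncate_le (s : Finset I) (f : lp G 2) : ‖truncate G s f‖ ≤ ‖f‖ := by
  have := norm_sq_eq_truncate_add s f
  exact le_of_sq_le_sq (by nlinarith [sq_nonneg ‖f - truncate G s f‖]) (norm_nonneg f)

/-- With a and b the two values of g, test g on the combination with coefficients conj a and conj b.
Orthogonality of truncation and remainder bounds its squared norm by t = |a|² + |b|², while g takes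
the value t there, so t² ≤ ‖g‖² t. -/
theorem sq_add_sq_le_of_truncate (g : StrongDual ℂ (lp G 2)) (s : Finset I) {u v : lp G 2}
    (hu : ‖u‖ ≤ 1) (hv : ‖v‖ ≤ 1) :
    ‖g (truncate G s u)‖ ^ 2 + ‖g (v - truncate G s v)‖ ^ 2 ≤ ‖g‖ ^ 2 := by
  set a := g (truncate G s u)
  set b := g (v - truncate G s v)
  set t := ‖a‖ ^ 2 + ‖b‖ ^ 2 with ht
  set f := (starRingEnd ℂ a) • truncate G s u + (starRingEnd ℂ b) • (v - truncate G s v) with hf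
  have hQ : truncate G s f = (starRingEnd ℂ a) • truncate G s u := by
    simp [hf, truncate_truncate]
  have hgf : g f = (t : ℂ) := by
    rw [hf, map_add, map_smul, map_smul, smul_eq_mul, smul_eq_mul, ht]
    push_cast
    rw [← Complex.conj_mul', ← Complex.conj_mul']
  have h1 : ‖truncate G s u‖ ^ 2 ≤ 1 :=
    pow_le_one₀ (norm_nonneg _) ((norm_truncate_le s u).trans hu)
  have h2 : ‖v - truncate G s v‖ ^ 2 ≤ 1 := by
    have := norm_sq_eq_truncate_add s v
    nlinarith [sq_nonneg ‖truncate G s v‖, pow_le_one₀ (n := 2) (norm_nonneg v) hv]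
  have hft : ‖f‖ ^ 2 ≤ t := by
    rw [norm_sq_eq_truncate_add s f, hQ]
    have : f - (starRingEnd ℂ a) • truncate G s u =
      (starRingEnd ℂ b) • (v - truncate G s v) := by rw [hf]; abel
    rw [this, norm_smul, norm_smul, mul_pow, mul_pow, RCLike.norm_conj, RCLike.norm_conj]
    exact add_le_add (mul_le_of_le_one_right (sq_nonneg _) h1)
      (mul_le_of_le_one_right (sq_nonneg _) h2)
  have ht0 : 0 ≤ t := by positivity
  have h3 : t ≤ ‖g‖ * ‖f‖ := by
    have := g.le_opNorm f
    rwa [hgf, Complex.norm_real, Real.norm_of_nonneg ht0] at this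
  have h4 : t * t ≤ ‖g‖ ^ 2 * t := by
    calc t * t ≤ (‖g‖ * ‖f‖) * (‖g‖ * ‖f‖) := mul_self_le_mul_self ht0 h3
      _ = ‖g‖ ^ 2 * ‖f‖ ^ 2 := by ring
      _ ≤ ‖g‖ ^ 2 * t := mul_le_mul_of_nonneg_left hft (sq_nonneg _)
  rcases ht0.eq_or_lt with h0 | h0
  · rw [← h0]; positivity
  · exact le_of_mul_le_mul_right h4 h0

/-- A functional on square-summable families is a norm limit of its truncations. -/
theorem exists_norm_sub_comp_truncate_le (g : StrongDual ℂ (lp G 2)) {ε : ℝ} (hε : 0 < ε) :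
    ∃ s : Finset I, ‖g - g.comp (truncate G s)‖ ≤ ε := by
  rcases le_or_gt ‖g‖ ε with hg | hg
  · exact ⟨∅, by simpa [truncate] using hg⟩
  -- Once g exceeds this threshold on a truncated unit vector, `sq_add_sq_le_of_truncate` leaves at
  -- most ε for g on the remainders.
  have hlt : Real.sqrt (‖g‖ ^ 2 - ε ^ 2) < ‖g‖ := by
    rw [Real.sqrt_lt' (hε.trans hg)]
    nlinarith
  obtain ⟨u, hu, hgu⟩ := g.exists_lt_apply_of_lt_opNorm hlt
  have htend : Filter.Tendsto (fun s => ‖g (truncate G s u)‖) Filter.atTop (nhds ‖g u‖) := by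
    have h : HasSum (fun i => lp.single 2 i (u i)) u := lp.hasSum_single (by simp) u
    have := ((g.continuous.tendsto u).comp h).norm
    simpa [Function.comp_def, truncate_apply] using this
  obtain ⟨s, hs⟩ := (htend.eventually (lt_mem_nhds hgu)).exists
  refine ⟨s, ContinuousLinearMap.opNorm_le_of_unit_norm hε.le fun v hv => ?_⟩
  have h1 := sq_add_sq_le_of_truncate g s hu.le hv.le
  have h2 : ‖g‖ ^ 2 - ε ^ 2 < ‖g (truncate G s u)‖ ^ 2 :=
    Real.lt_sq_of_sqrt_lt hs
  have h3 : (g - g.comp (truncate G s)) v = g (v - truncate G s v) := by simp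
  rw [h3]
  exact le_of_sq_le_sq (by linarith) hε.le

end Truncation

/-- A functional on the dual of the square-summable families which in each coordinate is given by
evaluation at a point is itself given by evaluation at a square-summable family. -/
theorem exists_lp_of_coordinates (Φ : StrongDual ℂ (StrongDual ℂ (lp G 2))) (x : ∀ i, G i)
    (hx : ∀ i (ξ : StrongDual ℂ (G i)), Φ (ξ.comp (lp.evalCLM ℂ G 2 i)) = ξ (x i)) :
    ∃ y : lp G 2, (∀ i, y i = x i) ∧ ∀ g, Φ g = g y := by
  classical
  have hΦ : ∀ (g : StrongDual ℂ (lp G 2)) (s : Finset I),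
      Φ (g.comp (truncate G s)) = g (∑ i ∈ s, lp.single 2 i (x i)) := by
    intro g s
    have : g.comp (truncate G s) = ∑ i ∈ s,
        (g.comp (lp.singleContinuousLinearMap ℂ G 2 i)).comp (lp.evalCLM ℂ G 2 i) := by
      ext f
      simp [truncate]
    rw [this, map_sum, map_sum]
    exact Finset.sum_congr rfl fun i _ => hx i _
  -- Apply Φ to a norming functional of the partial sum precomposed with the truncation, which is a
  -- contraction.
  have hle : ∀ s : Finset I, ‖∑ i ∈ s, lp.single (E := G) 2 i (x i)‖ ≤ ‖Φ‖ := by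
    intro s
    obtain ⟨g, hg1, hg⟩ := exists_dual_vector'' ℂ (∑ i ∈ s, lp.single (E := G) 2 i (x i))
    have h1 : ‖g.comp (truncate G s)‖ ≤ 1 :=
      ContinuousLinearMap.opNorm_le_bound _ zero_le_one fun f =>
        (g.le_of_opNorm_le hg1 _).trans
          (mul_le_mul_of_nonneg_left (norm_truncate_le s f) zero_le_one)
    have h2 := Φ.le_of_opNorm_le_of_le le_rfl h1
    rw [hΦ, hg] at h2
    simpa using h2
  have hsum : ∀ s : Finset I, ∑ i ∈ s, ‖x i‖ ^ 2 ≤ ‖Φ‖ ^ 2 := by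
    intro s
    have h1 := lp.norm_sum_single (p := 2) (by simp) x s
    norm_num at h1
    rw [← h1]
    exact pow_le_pow_left₀ (norm_nonneg _) (hle s) 2
  refine ⟨⟨x, memℓp_two_of_sum_le hsum⟩, fun i => rfl, fun g => ?_⟩
  set y : lp G 2 := ⟨x, memℓp_two_of_sum_le hsum⟩ with hy
  -- Φ and evaluation at y agree on truncated functionals, so only the part of g removed by
  -- truncation contributes, and its norm can be made small.
  have key : ∀ s : Finset I, Φ g - g y =
      Φ (g - g.comp (truncate G s)) - (g - g.comp (truncate G s)) y := by
    intro s
    have : truncate G s y = ∑ i ∈ s, lp.single 2 i (x i) := truncate_apply s y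
    rw [map_sub, hΦ]
    simp [this]
  have hzero : ‖Φ g - g y‖ ≤ 0 := by
    refine le_of_forall_pos_le_add fun δ hδ => ?_
    have hpos : 0 < ‖Φ‖ + ‖y‖ + 1 := by positivity
    obtain ⟨s, hs⟩ := exists_norm_sub_comp_truncate_le g (div_pos hδ hpos)
    rw [key s]
    calc ‖Φ (g - g.comp (truncate G s)) - (g - g.comp (truncate G s)) y‖
        ≤ ‖Φ‖ * (δ / (‖Φ‖ + ‖y‖ + 1)) + (δ / (‖Φ‖ + ‖y‖ + 1)) * ‖y‖ :=
          norm_sub_le_of_le (Φ.le_opNorm_of_le hs) (ContinuousLinearMap.le_of_opNorm_le _ hs _)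
      _ = (‖Φ‖ + ‖y‖) * δ / (‖Φ‖ + ‖y‖ + 1) := by ring
      _ ≤ 0 + δ := by
          rw [zero_add, div_le_iff₀ hpos]
          nlinarith
  exact sub_eq_zero.1 (norm_le_zero_iff.1 hzero)

/-- The space of square-summable families in reflexive spaces is reflexive. -/
theorem isReflexive_lp (hG : ∀ i, IsReflexive (G i)) : IsReflexive (lp G 2) := by
  intro Φ
  choose x hx using fun i => hG i (Φ.comp
    ((ContinuousLinearMap.compL ℂ (lp G 2) (G i) ℂ).flip (lp.evalCLM ℂ G 2 i)))
  obtain ⟨y, -, hy⟩ := exists_lp_of_coordinates Φ x fun i ξ =>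
    (congrArg (fun Ψ : StrongDual ℂ (StrongDual ℂ (G i)) => Ψ ξ) (hx i)).symm
  exact ⟨y, by ext g; exact (hy g).symm⟩

end SquareSum

/-! ### Weakly compact operators -/

section WeaklyCompact

variable {Z X Y W : Type*} [NormedAddCommGroup Z] [NormedSpace ℂ Z]
  [NormedAddCommGroup X] [NormedSpace ℂ X] [NormedAddCommGroup Y] [NormedSpace ℂ Y]
  [NormedAddCommGroup W] [NormedSpace ℂ W]

/-- The transpose `ξ ↦ ξ ∘ T` of a bounded operator. -/
def transpose (T : Z →L[ℂ] X) : StrongDual ℂ X →L[ℂ] StrongDual ℂ Z :=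
  (ContinuousLinearMap.compL ℂ Z X ℂ).flip T

@[simp]
theorem transpose_apply (T : Z →L[ℂ] X) (ξ : StrongDual ℂ X) : transpose T ξ = ξ.comp T := rfl

/-- The second adjoint of `T` takes values in the canonical image of `X`. -/
def IsWeaklyCompact (T : Z →L[ℂ] X) : Prop :=
  ∀ α : StrongDual ℂ (StrongDual ℂ Z), ∃ x : X, ∀ ξ : StrongDual ℂ X, α (ξ.comp T) = ξ x

theorem IsWeaklyCompact.add {S T : Z →L[ℂ] X} (hS : IsWeaklyCompact S) (hT : IsWeaklyCompact T) :
    IsWeaklyCompact (S + T) := fun α => by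
  obtain ⟨x, hx⟩ := hS α
  obtain ⟨y, hy⟩ := hT α
  exact ⟨x + y, fun ξ => by rw [ContinuousLinearMap.comp_add, map_add, hx, hy, map_add]⟩

theorem IsWeaklyCompact.comp_comp {T : Z →L[ℂ] X} (hT : IsWeaklyCompact T) (R : X →L[ℂ] Y)
    (S : W →L[ℂ] Z) : IsWeaklyCompact (R.comp (T.comp S)) := fun α => by
  obtain ⟨x, hx⟩ := hT (α.comp (transpose S))
  exact ⟨R x, fun ξ => hx (ξ.comp R)⟩

theorem isWeaklyCompact_smulRight (c : StrongDual ℂ Z) (x : X) :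
    IsWeaklyCompact (c.smulRight x) := fun α =>
  ⟨α c • x, fun ξ => by
    have : ξ.comp (c.smulRight x) = ξ x • c := by
      ext z
      simp [mul_comm]
    rw [this, map_smul, map_smul, smul_eq_mul, smul_eq_mul, mul_comm]⟩

/-- A functional dominated by `‖u v‖` factors through `u`, with the same bound. -/
theorem exists_dual_comp_eq (u : Z →L[ℂ] X) (f : StrongDual ℂ Z) {C : ℝ} (hC : 0 ≤ C)
    (h : ∀ z, ‖f z‖ ≤ C * ‖u z‖) : ∃ g : StrongDual ℂ X, ‖g‖ ≤ C ∧ g.comp u = f := by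
  have hker : LinearMap.ker (u : Z →ₗ[ℂ] X) ≤ LinearMap.ker (f : Z →ₗ[ℂ] ℂ) := fun z hz => by
    have hz' : u z = 0 := hz
    have := h z
    rw [hz', norm_zero, mul_zero] at this
    exact norm_le_zero_iff.1 this
  let e := (u : Z →ₗ[ℂ] X).quotKerEquivRange
  let g₀ : LinearMap.range (u : Z →ₗ[ℂ] X) →ₗ[ℂ] ℂ :=
    ((LinearMap.ker (u : Z →ₗ[ℂ] X)).liftQ (f : Z →ₗ[ℂ] ℂ) hker).comp e.symm.toLinearMap
  have hg₀ : ∀ z, g₀ ⟨u z, z, rfl⟩ = f z := fun z => by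
    have : e.symm ⟨u z, z, rfl⟩ = Submodule.Quotient.mk z := by
      rw [LinearEquiv.symm_apply_eq]
      rfl
    change (LinearMap.ker (u : Z →ₗ[ℂ] X)).liftQ (f : Z →ₗ[ℂ] ℂ) hker (e.symm ⟨u z, z, rfl⟩) = f z
    rw [this]
    rfl
  have hb : ∀ y, ‖g₀ y‖ ≤ C * ‖y‖ := by
    rintro ⟨_, z, rfl⟩
    exact (congrArg norm (hg₀ z)).trans_le (h z)
  obtain ⟨g, hg, hgn⟩ := exists_extension_norm_eq _ (g₀.mkContinuous C hb)
  refine ⟨g, hgn.trans_le (LinearMap.mkContinuous_norm_le _ hC _), ?_⟩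
  ext z
  exact (hg ⟨u z, z, rfl⟩).trans (hg₀ z)

/-- An element of the bidual of a Banach space that is approximated by elements of the space lies in
the space. -/
theorem exists_eq_inclusionInDoubleDual [CompleteSpace X] (Ψ : StrongDual ℂ (StrongDual ℂ X))
    (h : ∀ ε > 0, ∃ x : X, ∀ ξ, ‖Ψ ξ - ξ x‖ ≤ ε * ‖ξ‖) : ∃ x : X, ∀ ξ, Ψ ξ = ξ x := by
  have hcl : IsClosed (Set.range (NormedSpace.inclusionInDoubleDualLi ℂ (E := X))) :=
    (NormedSpace.inclusionInDoubleDualLi ℂ (E := X)).isometry.isUniformInducing.isComplete_range.isClosed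
  have hmem : Ψ ∈ Set.range (NormedSpace.inclusionInDoubleDualLi ℂ (E := X)) := by
    rw [← hcl.closure_eq]
    refine (Metric.mem_closure_iff (α := StrongDual ℂ (StrongDual ℂ X))).2 fun ε hε => ?_
    obtain ⟨x, hx⟩ := h (ε / 2) (half_pos hε)
    refine ⟨_, ⟨x, rfl⟩, ?_⟩
    refine (dist_eq_norm Ψ (NormedSpace.inclusionInDoubleDual ℂ X x)).trans_lt ?_
    exact (ContinuousLinearMap.opNorm_le_bound _ (half_pos hε).le hx).trans_lt (half_lt_self hε)
  obtain ⟨x, hx⟩ := hmem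
  exact ⟨x, fun ξ => (congrArg (fun Θ : StrongDual ℂ (StrongDual ℂ X) => Θ ξ) hx).symm⟩

end WeaklyCompact

/-! ### Intermediate norms -/

section Step

variable {Z X : Type*} [NormedAddCommGroup Z] [NormedSpace ℂ Z]
  [NormedAddCommGroup X] [NormedSpace ℂ X]

/-- The map `(z, x) ↦ s T z + t x`. -/
def sumMap (T : Z →L[ℂ] X) (s t : ℝ) : Z × X →L[ℂ] X :=
  (s : ℂ) • T.comp (ContinuousLinearMap.fst ℂ Z X) + (t : ℂ) • ContinuousLinearMap.snd ℂ Z X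

@[simp]
theorem sumMap_apply (T : Z →L[ℂ] X) (s t : ℝ) (w : Z × X) :
    sumMap T s t w = (s : ℂ) • T w.1 + (t : ℂ) • w.2 := rfl

/-- For `t ≠ 0` this is the space `X` with the gauge of `s T(B) + t B'` as its norm, `B` and `B'`
being the unit balls. -/
abbrev Step (T : Z →L[ℂ] X) (s t : ℝ) : Type _ :=
  (Z × X) ⧸ LinearMap.ker (sumMap T s t : Z × X →ₗ[ℂ] X)

instance (T : Z →L[ℂ] X) (s t : ℝ) :
    IsClosed (LinearMap.ker (sumMap T s t : Z × X →ₗ[ℂ] X) : Set (Z × X)) :=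
  (sumMap T s t).isClosed_ker

variable (T : Z →L[ℂ] X) (s t : ℝ)

theorem Step.exists_rep (q : Step T s t) {ε : ℝ} (hε : 0 < ε) :
    ∃ w : Z × X, Submodule.Quotient.mk w = q ∧ ‖w‖ < ‖q‖ + ε :=
  QuotientAddGroup.exists_norm_mk_lt q hε

theorem Step.le_mul_norm {q : Step T s t} {r C : ℝ} (hC : 0 ≤ C)
    (h : ∀ w : Z × X, Submodule.Quotient.mk w = q → r ≤ C * ‖w‖) : r ≤ C * ‖q‖ := by
  refine le_of_forall_pos_le_add fun ε hε => ?_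
  -- Dividing the slack by C + 1 instead of C covers C = 0.
  have hC1 : 0 < C + 1 := by positivity
  obtain ⟨w, hw, hlt⟩ := Step.exists_rep T s t q (div_pos hε hC1)
  calc r ≤ C * ‖w‖ := h w hw
    _ ≤ C * (‖q‖ + ε / (C + 1)) := mul_le_mul_of_nonneg_left hlt.le hC
    _ = C * ‖q‖ + C * ε / (C + 1) := by ring
    _ ≤ C * ‖q‖ + ε := by
        gcongr
        rw [div_le_iff₀ hC1]
        nlinarith

/-- The canonical map from the renormed space to `X`. -/
def Step.toSpace : Step T s t →L[ℂ] X :=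
  ((LinearMap.ker (sumMap T s t : Z × X →ₗ[ℂ] X)).liftQ _ le_rfl).mkContinuous ‖sumMap T s t‖
    fun _ => Step.le_mul_norm T s t (norm_nonneg _) fun w hw => by
      subst hw
      exact (sumMap T s t).le_opNorm w

@[simp]
theorem Step.toSpace_mk (w : Z × X) :
    Step.toSpace T s t (Submodule.Quotient.mk w) = sumMap T s t w := rfl

theorem Step.toSpace_injective : Function.Injective (Step.toSpace T s t) := by
  refine (injective_iff_map_eq_zero _).2 fun q hq => ?_
  obtain ⟨w, rfl⟩ := Submodule.Quotient.mk_surjective _ q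
  exact (Submodule.Quotient.mk_eq_zero _).2 hq

theorem Step.norm_dual_toSpace_le (ξ : StrongDual ℂ X) (q : Step T s t) :
    ‖ξ (Step.toSpace T s t q)‖ ≤ ‖ξ.comp (sumMap T s t)‖ * ‖q‖ :=
  Step.le_mul_norm T s t (norm_nonneg _) fun w hw => by
    subst hw
    exact (ξ.comp (sumMap T s t)).le_opNorm w

/-- The canonical map from `X` to the renormed space. -/
def Step.ofSpace : X →L[ℂ] Step T s t :=
  ((LinearMap.ker (sumMap T s t : Z × X →ₗ[ℂ] X)).mkQ.comp
    ((t : ℂ)⁻¹ • LinearMap.inr ℂ Z X)).mkContinuous ‖(t : ℂ)⁻¹‖ fun x => by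
      refine (Submodule.Quotient.norm_mk_le _ _).trans_eq ?_
      simp only [LinearMap.smul_apply, LinearMap.inr_apply, norm_smul, Prod.norm_mk, norm_zero]
      rw [max_eq_right (norm_nonneg x)]

variable {t} in
theorem Step.toSpace_ofSpace (ht : 0 < t) (x : X) :
    Step.toSpace T s t (Step.ofSpace T s t x) = x := by
  have : (t : ℂ) ≠ 0 := by exact_mod_cast ht.ne'
  change sumMap T s t ((t : ℂ)⁻¹ • (0, x)) = x
  simp [this]

variable {T s t}

theorem Step.ofSpace_eq_mk (ht : 0 < t) {x : X} {w : Z × X} (h : sumMap T s t w = x) :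
    Step.ofSpace T s t x = Submodule.Quotient.mk w :=
  Step.toSpace_injective T s t ((Step.toSpace_ofSpace T s ht x).trans h.symm)

theorem Step.norm_toSpace_le (hT : ‖T‖ ≤ 1) (hs : 0 ≤ s) (ht : 0 < t) (q : Step T s t) :
    ‖Step.toSpace T s t q‖ ≤ (s + t) * ‖q‖ := by
  refine Step.le_mul_norm T s t (by positivity) fun w hw => ?_
  subst hw
  rw [Step.toSpace_mk, sumMap_apply, add_mul]
  refine norm_add_le_of_le ?_ ?_
  · rw [norm_smul, Complex.norm_real, Real.norm_of_nonneg hs]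
    gcongr
    exact ((T.le_of_opNorm_le hT _).trans_eq (one_mul _)).trans (norm_fst_le w)
  · rw [norm_smul, Complex.norm_real, Real.norm_of_nonneg ht.le]
    gcongr
    exact norm_snd_le w

theorem Step.norm_ofSpace_le (hT : ‖T‖ ≤ 1) (hs : 0 ≤ s) (ht : 0 < t) (z : Z) :
    ‖Step.ofSpace T s t (T z)‖ ≤ (s + t)⁻¹ * ‖z‖ := by
  have hst : 0 < s + t := by positivity
  have hc : ((s : ℂ) + t) ≠ 0 := by exact_mod_cast hst.ne'
  -- Using the same multiple of z and T z in the two slots gives the constant (s + t)⁻¹ in the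
  -- maximum norm of Z × X.
  have h : sumMap T s t (((s : ℂ) + t)⁻¹ • (z, T z)) = T z := by
    rw [map_smul, sumMap_apply, ← add_smul, smul_smul, inv_mul_cancel₀ hc, one_smul]
  rw [Step.ofSpace_eq_mk ht h]
  refine (Submodule.Quotient.norm_mk_le _ _).trans ?_
  rw [norm_smul, norm_inv, ← Complex.ofReal_add, Complex.norm_real, Real.norm_of_nonneg hst.le]
  gcongr
  exact max_le le_rfl ((T.le_of_opNorm_le hT z).trans_eq (one_mul _))

/-- A pair of operators intertwined by `T` acts on the renormed space. -/
def Step.map {l : Z →L[ℂ] Z} {m : X →L[ℂ] X} (h : T.comp l = m.comp T) : Step T s t →L[ℂ] Step T s t :=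
  (Submodule.mapQ (LinearMap.ker (sumMap T s t : Z × X →ₗ[ℂ] X))
    (LinearMap.ker (sumMap T s t : Z × X →ₗ[ℂ] X)) (l.prodMap m : Z × X →ₗ[ℂ] Z × X)
    fun w hw => by
      have hw' : sumMap T s t w = 0 := hw
      have h1 : T (l w.1) = m (T w.1) := congrArg (fun f : Z →L[ℂ] X => f w.1) h
      change sumMap T s t (l w.1, m w.2) = 0
      have h2 : sumMap T s t (l w.1, m w.2) = m (sumMap T s t w) := by simp [h1]
      rw [h2, hw', map_zero]).mkContinuous ‖l.prodMap m‖ fun _ =>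
    Step.le_mul_norm T s t (norm_nonneg _) fun w hw => by
      subst hw
      exact (Submodule.Quotient.norm_mk_le _ _).trans ((l.prodMap m).le_opNorm w)

theorem Step.norm_map_le {l : Z →L[ℂ] Z} {m : X →L[ℂ] X} (h : T.comp l = m.comp T) {C : ℝ}
    (hC : 0 ≤ C) (hl : ‖l‖ ≤ C) (hm : ‖m‖ ≤ C) :
    ‖(Step.map h : Step T s t →L[ℂ] Step T s t)‖ ≤ C := by
  refine (LinearMap.mkContinuous_norm_le _ (norm_nonneg _) _).trans ?_
  refine ContinuousLinearMap.opNorm_le_bound _ hC fun w => ?_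
  refine max_le ((l.le_of_opNorm_le hl _).trans ?_) ((m.le_of_opNorm_le hm _).trans ?_)
  · exact mul_le_mul_of_nonneg_left (norm_fst_le w) hC
  · exact mul_le_mul_of_nonneg_left (norm_snd_le w) hC

theorem Step.map_ofSpace {l : Z →L[ℂ] Z} {m : X →L[ℂ] X} (h : T.comp l = m.comp T) (x : X) :
    Step.map h (Step.ofSpace T s t x) = Step.ofSpace T s t (m x) := by
  change Submodule.Quotient.mk (l.prodMap m ((t : ℂ)⁻¹ • ((0 : Z), x))) =
    Submodule.Quotient.mk ((t : ℂ)⁻¹ • ((0 : Z), m x))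
  simp

end Step

/-! ### Factorization of weakly compact operators through reflexive spaces -/

section Interpolation

/-- The weight of the second unit ball in the `n`-th norm. -/
def weightSnd (n : ℕ) : ℝ := (1 / 2) ^ n

/-- The weight of the first unit ball in the `n`-th norm. -/
def weightFst (n : ℕ) : ℝ := Real.sqrt 2 ^ (n + 1) - weightSnd n

theorem weightSnd_pos (n : ℕ) : 0 < weightSnd n := by unfold weightSnd; positivity

theorem weight_add (n : ℕ) : weightFst n + weightSnd n = Real.sqrt 2 ^ (n + 1) := by
  unfold weightFst; ring

theorem weightFst_nonneg (n : ℕ) : 0 ≤ weightFst n := by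
  have h1 : weightSnd n ≤ 1 := pow_le_one₀ (by norm_num) (by norm_num)
  have h2 : (1 : ℝ) ≤ Real.sqrt 2 ^ (n + 1) := one_le_pow₀ (Real.one_le_sqrt.2 (by norm_num))
  unfold weightFst
  linarith

/-- The weights are chosen for this: the terms are 2⁻⁽ⁿ⁺¹⁾ and the total is exactly 1, so both maps
of the factorization have norm at most 1. -/
theorem hasSum_inv_weight_sq : HasSum (fun n => ((weightFst n + weightSnd n)⁻¹) ^ 2) 1 := by
  convert hasSum_geometric_two' 1 using 2 with n
  rw [weight_add, inv_pow, ← pow_mul, mul_comm, pow_mul, Real.sq_sqrt (by norm_num), pow_succ]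
  field_simp

variable {Z X : Type u} [NormedAddCommGroup Z] [NormedSpace ℂ Z]
  [NormedAddCommGroup X] [NormedSpace ℂ X]

/-- The space `F` with the maps `J` and `ι` is a reflexive space, between `T(Z)` and `X`, on which
the pairs of operators intertwined by `T` act. -/
structure IsInterpolationSpace (T : Z →L[ℂ] X) {F : Type*} [NormedAddCommGroup F] [NormedSpace ℂ F]
    (J : LinearMap.range (T : Z →ₗ[ℂ] X) →ₗ[ℂ] F) (ι : F →L[ℂ] X) : Prop where
  isReflexive : IsReflexive F
  injective : Function.Injective ι
  denseRange : DenseRange J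
  apply_apply : ∀ x, ι (J x) = x
  norm_le : ∀ y, ‖ι y‖ ≤ ‖y‖
  norm_apply_le : ∀ z, ‖J ⟨T z, z, rfl⟩‖ ≤ ‖z‖
  exists_lift : ∀ (l : Z →L[ℂ] Z) (m : X →L[ℂ] X) (C : ℝ), 0 ≤ C → T.comp l = m.comp T →
    ‖l‖ ≤ C → ‖m‖ ≤ C → ∃ S : F →L[ℂ] F, ‖S‖ ≤ C ∧ ∀ y, ι (S y) = m (ι y)

/-- The square-summable families in the renormed spaces. -/
abbrev StepSum (T : Z →L[ℂ] X) : Type u :=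
  lp (fun n => Step T (weightFst n) (weightSnd n)) 2

variable {T : Z →L[ℂ] X}

/-- An operator whose transpose is dominated by those of all the maps `(z, x) ↦ s T z + t x`, for
the given weights, is weakly compact if `T` is. -/
theorem IsWeaklyCompact.of_norm_comp_le {F : Type*} [NormedAddCommGroup F] [NormedSpace ℂ F]
    [CompleteSpace X] (hW : IsWeaklyCompact T) {ι : F →L[ℂ] X}
    (h : ∀ (ξ : StrongDual ℂ X) (n : ℕ),
      ‖ξ.comp ι‖ ≤ ‖ξ.comp (sumMap T (weightFst n) (weightSnd n))‖) :
    IsWeaklyCompact ι := by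
  intro Φ
  refine exists_eq_inclusionInDoubleDual (Φ.comp (transpose ι)) fun ε hε => ?_
  have htend : Filter.Tendsto (fun n => weightSnd n * ‖Φ‖) Filter.atTop (nhds 0) := by
    have : Filter.Tendsto weightSnd Filter.atTop (nhds 0) :=
      tendsto_pow_atTop_nhds_zero_of_lt_one (by norm_num) (by norm_num)
    simpa using this.mul_const ‖Φ‖
  obtain ⟨n, hn⟩ := (htend.eventually (gt_mem_nhds hε)).exists
  -- Domination by the n-th map turns Φ into an element Θ of the bidual of Z × X, of norm at most
  -- ‖Φ‖.
  obtain ⟨Θ, hΘ, hΘΦ⟩ := exists_dual_comp_eq (transpose (sumMap T (weightFst n) (weightSnd n)))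
    (Φ.comp (transpose ι)) (norm_nonneg Φ)
    fun ξ => Φ.le_opNorm_of_le (h ξ n)
  -- Weak compactness of T represents the Z-part of Θ by a point of X. The X-part carries the weight
  -- `weightSnd n`, so it is an error of at most ε ‖ξ‖.
  obtain ⟨x, hx⟩ := hW (Θ.comp (transpose (ContinuousLinearMap.fst ℂ Z X)))
  refine ⟨(weightFst n : ℂ) • x, fun ξ => ?_⟩
  have h1 : ξ.comp (sumMap T (weightFst n) (weightSnd n)) =
      (weightFst n : ℂ) • (ξ.comp T).comp (ContinuousLinearMap.fst ℂ Z X) +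
        (weightSnd n : ℂ) • ξ.comp (ContinuousLinearMap.snd ℂ Z X) := by
    simp only [sumMap, ContinuousLinearMap.comp_add, ContinuousLinearMap.comp_smul,
      ContinuousLinearMap.comp_assoc]
  have h2 : (Φ.comp (transpose ι)) ξ - ξ ((weightFst n : ℂ) • x) =
      (weightSnd n : ℂ) • Θ (ξ.comp (ContinuousLinearMap.snd ℂ Z X)) := by
    have hx' : Θ ((ξ.comp T).comp (ContinuousLinearMap.fst ℂ Z X)) = ξ x := hx ξ
    rw [← hΘΦ, ContinuousLinearMap.comp_apply, transpose_apply, h1, map_add, map_smul, map_smul,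
      hx', map_smul]
    abel
  have h3 : ‖ξ.comp (ContinuousLinearMap.snd ℂ Z X)‖ ≤ ‖ξ‖ :=
    ContinuousLinearMap.opNorm_le_bound _ (norm_nonneg _) fun w =>
      ξ.le_opNorm_of_le (norm_snd_le w)
  rw [h2, norm_smul, Complex.norm_real, Real.norm_of_nonneg (weightSnd_pos n).le]
  calc weightSnd n * ‖Θ (ξ.comp (ContinuousLinearMap.snd ℂ Z X))‖
      ≤ weightSnd n * (‖Φ‖ * ‖ξ‖) := mul_le_mul_of_nonneg_left
        (Θ.le_of_opNorm_le_of_le hΘ h3) (weightSnd_pos n).le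
    _ = weightSnd n * ‖Φ‖ * ‖ξ‖ := by ring
    _ ≤ ε * ‖ξ‖ := mul_le_mul_of_nonneg_right hn.le (norm_nonneg _)

theorem sum_norm_ofSpace_sq_le (hT : ‖T‖ ≤ 1) (z : Z) (s : Finset ℕ) :
    ∑ n ∈ s, ‖Step.ofSpace T (weightFst n) (weightSnd n) (T z)‖ ^ 2 ≤ ‖z‖ ^ 2 := by
  calc ∑ n ∈ s, ‖Step.ofSpace T (weightFst n) (weightSnd n) (T z)‖ ^ 2
      ≤ ∑ n ∈ s, ((weightFst n + weightSnd n)⁻¹) ^ 2 * ‖z‖ ^ 2 :=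
        Finset.sum_le_sum fun n _ => by
          rw [← mul_pow]
          exact pow_le_pow_left₀ (norm_nonneg _)
            (Step.norm_ofSpace_le hT (weightFst_nonneg n) (weightSnd_pos n) z) 2
    _ = (∑ n ∈ s, ((weightFst n + weightSnd n)⁻¹) ^ 2) * ‖z‖ ^ 2 := by rw [Finset.sum_mul]
    _ ≤ 1 * ‖z‖ ^ 2 := mul_le_mul_of_nonneg_right
        (sum_le_hasSum s (fun n _ => sq_nonneg _) hasSum_inv_weight_sq) (sq_nonneg _)
    _ = ‖z‖ ^ 2 := one_mul _

/-- The diagonal embedding of the range of `T`. -/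
def diagonal (hT : ‖T‖ ≤ 1) : LinearMap.range (T : Z →ₗ[ℂ] X) →ₗ[ℂ] StepSum T where
  toFun x := ⟨fun n => Step.ofSpace T (weightFst n) (weightSnd n) x, by
    obtain ⟨_, z, rfl⟩ := x
    exact memℓp_two_of_sum_le (sum_norm_ofSpace_sq_le hT z)⟩
  map_add' x y := by
    ext n
    exact map_add (Step.ofSpace T (weightFst n) (weightSnd n)) (x : X) y
  map_smul' c x := by
    ext n
    exact map_smul (Step.ofSpace T (weightFst n) (weightSnd n)) c (x : X)

/-- The closure of the diagonal. -/
abbrev Interp (hT : ‖T‖ ≤ 1) : Submodule ℂ (StepSum T) :=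
  (LinearMap.range (diagonal hT)).topologicalClosure

theorem isClosed_interp (hT : ‖T‖ ≤ 1) : IsClosed (Interp hT : Set (StepSum T)) :=
  Submodule.isClosed_topologicalClosure _

/-- The diagonal embedding into the closure of the diagonal. -/
def toInterp (hT : ‖T‖ ≤ 1) : LinearMap.range (T : Z →ₗ[ℂ] X) →ₗ[ℂ] Interp hT :=
  (diagonal hT).codRestrict _ fun x => Submodule.le_topologicalClosure _ ⟨x, rfl⟩

theorem denseRange_toInterp (hT : ‖T‖ ≤ 1) : DenseRange (toInterp hT) := by
  rintro ⟨y, hy⟩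
  rw [closure_subtype]
  refine closure_mono ?_ hy
  rintro _ ⟨x, rfl⟩
  exact ⟨_, ⟨x, rfl⟩, rfl⟩

/-- The inclusion of the interpolation space into `X`. -/
def ofInterp (hT : ‖T‖ ≤ 1) : Interp hT →L[ℂ] X :=
  ((Step.toSpace T (weightFst 0) (weightSnd 0)).comp (lp.evalCLM ℂ _ 2 0)).comp (Interp hT).subtypeL

theorem ofInterp_toInterp (hT : ‖T‖ ≤ 1) (x : LinearMap.range (T : Z →ₗ[ℂ] X)) :
    ofInterp hT (toInterp hT x) = x :=
  Step.toSpace_ofSpace T _ (weightSnd_pos 0) x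

/-- The identity holds on the diagonal and both sides are continuous. So closing up adds only
diagonal sequences, and an element is determined by its image in X. -/
theorem interp_apply (hT : ‖T‖ ≤ 1) (y : Interp hT) (n : ℕ) :
    (y : StepSum T) n = Step.ofSpace T (weightFst n) (weightSnd n) (ofInterp hT y) := by
  refine (denseRange_toInterp hT).induction_on y
    (isClosed_eq ?_ ?_) fun x => ?_
  · exact ((lp.evalCLM ℂ _ 2 n).comp (Interp hT).subtypeL).continuous
  · exact ((Step.ofSpace T (weightFst n) (weightSnd n)).comp (ofInterp hT)).continuous
  · rw [ofInterp_toInterp]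
    rfl

theorem ofInterp_eq_toSpace (hT : ‖T‖ ≤ 1) (y : Interp hT) (n : ℕ) :
    ofInterp hT y = Step.toSpace T (weightFst n) (weightSnd n) ((y : StepSum T) n) := by
  rw [interp_apply, Step.toSpace_ofSpace T _ (weightSnd_pos n)]

theorem ofInterp_injective (hT : ‖T‖ ≤ 1) : Function.Injective (ofInterp hT) := fun y y' h => by
  ext n
  rw [interp_apply, interp_apply, h]

/-- The n-th coordinate has norm at least (s_n + t_n)⁻¹ ‖ι y‖, and the squares of these factors sum
to 1. -/
theorem norm_ofInterp_le (hT : ‖T‖ ≤ 1) (y : Interp hT) : ‖ofInterp hT y‖ ≤ ‖y‖ := by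
  refine le_of_sq_le_sq ?_ (norm_nonneg y)
  have h1 := hasSum_inv_weight_sq.mul_right (‖ofInterp hT y‖ ^ 2)
  rw [one_mul] at h1
  refine hasSum_le (fun n => ?_) h1 (hasSum_norm_sq (y : StepSum T))
  have hpos : 0 < weightFst n + weightSnd n :=
    add_pos_of_nonneg_of_pos (weightFst_nonneg n) (weightSnd_pos n)
  rw [← mul_pow]
  refine pow_le_pow_left₀ (by positivity) ?_ 2
  rw [inv_mul_le_iff₀ hpos, ofInterp_eq_toSpace hT y n]
  exact Step.norm_toSpace_le hT (weightFst_nonneg n) (weightSnd_pos n) _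

theorem norm_toInterp_le (hT : ‖T‖ ≤ 1) (z : Z) : ‖toInterp hT ⟨T z, z, rfl⟩‖ ≤ ‖z‖ :=
  norm_le_of_sum_sq_le (f := diagonal hT ⟨T z, z, rfl⟩) (norm_nonneg z)
    (sum_norm_ofSpace_sq_le hT z)

theorem norm_comp_ofInterp_le (hT : ‖T‖ ≤ 1) (ξ : StrongDual ℂ X) (n : ℕ) :
    ‖ξ.comp (ofInterp hT)‖ ≤ ‖ξ.comp (sumMap T (weightFst n) (weightSnd n))‖ := by
  refine ContinuousLinearMap.opNorm_le_bound _ (norm_nonneg _) fun y => ?_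
  rw [ContinuousLinearMap.comp_apply, ofInterp_eq_toSpace hT y n]
  exact (Step.norm_dual_toSpace_le T _ _ ξ _).trans (mul_le_mul_of_nonneg_left
    (lp.norm_apply_le_norm (by simp) (y : StepSum T) n) (norm_nonneg _))

theorem isWeaklyCompact_ofInterp [CompleteSpace X] (hT : ‖T‖ ≤ 1) (hW : IsWeaklyCompact T) :
    IsWeaklyCompact (ofInterp hT) :=
  hW.of_norm_comp_le (norm_comp_ofInterp_le hT)

/-- The renormed spaces need not be reflexive. Instead, weak compactness of the inclusion into X
yields one x whose images are the coordinates of Φ. These assemble to an element y of the square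
sum, and Hahn–Banach places y in the closed diagonal. -/
theorem isReflexive_interp [CompleteSpace X] (hT : ‖T‖ ≤ 1) (hW : IsWeaklyCompact T) :
    IsReflexive (Interp hT) := by
  intro Φ
  obtain ⟨x, hx⟩ := isWeaklyCompact_ofInterp hT hW Φ
  obtain ⟨y, -, hy⟩ := exists_lp_of_coordinates (Φ.comp (transpose (Interp hT).subtypeL))
    (fun n => Step.ofSpace T (weightFst n) (weightSnd n) x) fun n ξ => by
      rw [← ContinuousLinearMap.comp_apply, ← hx]
      refine congrArg Φ ?_
      ext y
      exact congrArg ξ (interp_apply hT y n)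
  have hmem : y ∈ Interp hT := mem_of_forall_dual_eq_zero (isClosed_interp hT) fun g hg => by
    rw [← hy g]
    have : transpose (Interp hT).subtypeL g = 0 := by
      ext w
      exact hg w w.2
    rw [ContinuousLinearMap.comp_apply, this, map_zero]
  refine ⟨⟨y, hmem⟩, ?_⟩
  ext f
  obtain ⟨g, hg, -⟩ := exists_extension_norm_eq (Interp hT) f
  have hgf : transpose (Interp hT).subtypeL g = f := by
    ext w
    exact hg w
  have := hy g
  rw [ContinuousLinearMap.comp_apply, hgf] at this
  exact ((hg ⟨y, hmem⟩).symm.trans this.symm)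

/-- The pair acts on every renormed space with the same bound C, hence coordinatewise on the square
sum. It preserves the diagonal over the range of T because m T = T l, and so also its closure. -/
theorem exists_interp_lift (hT : ‖T‖ ≤ 1) {l : Z →L[ℂ] Z} {m : X →L[ℂ] X} {C : ℝ} (hC : 0 ≤ C)
    (h : T.comp l = m.comp T) (hl : ‖l‖ ≤ C) (hm : ‖m‖ ≤ C) :
    ∃ S : Interp hT →L[ℂ] Interp hT, ‖S‖ ≤ C ∧ ∀ y, ofInterp hT (S y) = m (ofInterp hT y) := by
  let D : StepSum T →L[ℂ] StepSum T :=
    diagOp hC (fun n => Step.map h) fun n => Step.norm_map_le h hC hl hm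
  have hD : ∀ y ∈ Interp hT, D y ∈ Interp hT := by
    intro y hy
    refine map_mem_closure D.continuous hy ?_
    rintro _ ⟨⟨_, z, rfl⟩, rfl⟩
    refine ⟨⟨m (T z), l z, congrArg (fun f : Z →L[ℂ] X => f z) h⟩, ?_⟩
    ext n
    exact (Step.map_ofSpace h (T z)).symm
  refine ⟨(D.comp (Interp hT).subtypeL).codRestrict _ fun y => hD y y.2, ?_, fun y => ?_⟩
  · exact ContinuousLinearMap.opNorm_le_bound _ hC fun y =>
      D.le_of_opNorm_le (norm_diagOp_le hC _ _) (y : StepSum T)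
  · have h0 : D (y : StepSum T) 0 = Step.map h ((y : StepSum T) 0) := rfl
    rw [ofInterp_eq_toSpace hT _ 0]
    change Step.toSpace T _ _ (D (y : StepSum T) 0) = _
    rw [h0, interp_apply hT y 0, Step.map_ofSpace, Step.toSpace_ofSpace T _ (weightSnd_pos 0)]

/-- A weakly compact operator of norm at most one factors through a reflexive space. -/
theorem IsWeaklyCompact.exists_isInterpolationSpace [CompleteSpace Z] [CompleteSpace X]
    (hT : ‖T‖ ≤ 1) (hW : IsWeaklyCompact T) :
    ∃ (F : Type u) (_ : NormedAddCommGroup F) (_ : NormedSpace ℂ F) (_ : CompleteSpace F)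
      (J : LinearMap.range (T : Z →ₗ[ℂ] X) →ₗ[ℂ] F) (ι : F →L[ℂ] X), IsInterpolationSpace T J ι :=
  ⟨Interp hT, inferInstance, inferInstance, (isClosed_interp hT).completeSpace_coe,
    toInterp hT, ofInterp hT,
    { isReflexive := isReflexive_interp hT hW
      injective := ofInterp_injective hT
      denseRange := denseRange_toInterp hT
      apply_apply := ofInterp_toInterp hT
      norm_le := norm_ofInterp_le hT
      norm_apply_le := norm_toInterp_le hT
      exists_lift := fun _ _ _ hC h hl hm => exists_interp_lift hT hC h hl hm }⟩

end Interpolation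

/-! ### Weak-star continuity -/

section WeakStar

variable {X P : Type*} [NormedAddCommGroup P] [NormedSpace ℂ P]

theorem continuous_weakStar_apply (Φ : X → StrongDual ℂ P) (p : P) :
    Continuous[weakStar Φ, inferInstance] fun x => Φ x p :=
  letI := weakStar Φ
  (WeakDual.eval_continuous p).comp continuous_induced_dom

theorem continuous_weakStar_rng {Y : Type*} (τ : TopologicalSpace Y) (Φ : X → StrongDual ℂ P)
    {g : Y → X} (h : ∀ p : P, Continuous fun y => Φ (g y) p) : Continuous[τ, weakStar Φ] g :=
  continuous_induced_rng.2 (WeakDual.continuous_of_continuous_eval h)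

/-- This is the form of the topology required by `LinearMap.mem_span_iff_continuous`. -/
theorem weakStar_eq_iInf (Φ : X → StrongDual ℂ P) :
    weakStar Φ = ⨅ p : P, TopologicalSpace.induced (fun x => Φ x p) inferInstance := by
  refine le_antisymm (le_iInf fun p => continuous_iff_le_induced.1 (continuous_weakStar_apply Φ p))
    (continuous_id_iff_le.1 (continuous_weakStar_rng _ Φ fun p => ?_))
  exact continuous_iInf_dom (i := p) continuous_induced_dom

end WeakStar

/-! ### The predual as a space of functionals -/

section Predual

variable {A P : Type*} [NonUnitalNormedRing A] [NormedSpace ℂ A]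
  [NormedAddCommGroup P] [NormedSpace ℂ P] (D : DualBanachAlgebra A P)

theorem DualBanachAlgebra.embed_apply (p : P) (a : A) : D.embed p a = D.toDual a p := rfl

theorem DualBanachAlgebra.norm_embed (p : P) : ‖D.embed p‖ = ‖p‖ := by
  refine le_antisymm ?_ ?_
  · refine ContinuousLinearMap.opNorm_le_bound _ (norm_nonneg _) fun a => ?_
    rw [D.embed_apply, mul_comm, ← D.toDual.norm_map a]
    exact (D.toDual a).le_opNorm p
  · obtain ⟨f, hf, hfp⟩ := exists_dual_vector'' ℂ p
    have h1 : ‖D.toDual.symm f‖ ≤ 1 := (D.toDual.symm.norm_map f).trans_le hf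
    have h2 := (D.embed p).le_opNorm_of_le h1
    rw [D.embed_apply, D.toDual.apply_symm_apply, hfp] at h2
    simpa using h2

/-- The predual, as a subspace of the dual of the algebra. -/
def DualBanachAlgebra.predual : Submodule ℂ (StrongDual ℂ A) :=
  LinearMap.range (D.embed : P →ₗ[ℂ] StrongDual ℂ A)

theorem DualBanachAlgebra.embed_mem (p : P) : D.embed p ∈ D.predual := ⟨p, rfl⟩

theorem DualBanachAlgebra.isClosed_predual [CompleteSpace P] :
    IsClosed (D.predual : Set (StrongDual ℂ A)) :=
  (AddMonoidHomClass.isometry_of_norm D.embed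
    D.norm_embed).isUniformInducing.isComplete_range.isClosed

/-- Weak-star continuous functionals belong to the predual. -/
theorem DualBanachAlgebra.mem_predual_of_continuous {φ : StrongDual ℂ A}
    (h : Continuous[D.topology, inferInstance] φ) : φ ∈ D.predual := by
  let f : P →ₗ[ℂ] (A →ₗ[ℂ] ℂ) :=
    (ContinuousLinearMap.coeLM ℂ).comp (D.embed : P →ₗ[ℂ] StrongDual ℂ A)
  -- A functional continuous for the initial topology of a family of functionals lies in their
  -- linear span, and the predual is already a subspace.
  have h1 : (φ : A →ₗ[ℂ] ℂ) ∈ Submodule.span ℂ (Set.range f) := by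
    rw [LinearMap.mem_span_iff_continuous]
    rw [DualBanachAlgebra.topology, weakStar_eq_iInf] at h
    exact h
  rw [← LinearMap.coe_range, Submodule.span_eq] at h1
  obtain ⟨p, hp⟩ := h1
  exact ⟨p, ContinuousLinearMap.coe_injective hp⟩

/-- On the predual, a functional on the dual of the algebra is the evaluation at a point. -/
theorem DualBanachAlgebra.exists_bidual_eq (ξ : StrongDual ℂ (StrongDual ℂ A)) :
    ∃ b : A, ∀ φ ∈ D.predual, ξ φ = φ b := by
  refine ⟨D.toDual.symm (ξ.comp D.embed), ?_⟩
  rintro _ ⟨p, rfl⟩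
  change ξ (D.embed p) = D.toDual (D.toDual.symm (ξ.comp D.embed)) p
  rw [D.toDual.apply_symm_apply]
  rfl

variable [IsScalarTower ℂ A A] [SMulCommClass ℂ A A]

theorem DualBanachAlgebra.act_mem {φ : StrongDual ℂ A} (hφ : φ ∈ D.predual) (a : A) :
    act φ a ∈ D.predual := by
  obtain ⟨p, rfl⟩ := hφ
  have h := @Continuous.comp _ _ _ D.topology D.topology _ _ _
    (continuous_weakStar_apply D.toDual p) (D.continuous_mul_right a)
  exact D.mem_predual_of_continuous h

theorem DualBanachAlgebra.comp_mul_mem {φ : StrongDual ℂ A} (hφ : φ ∈ D.predual) (b : A) :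
    φ.comp (ContinuousLinearMap.mul ℂ A b) ∈ D.predual := by
  obtain ⟨p, rfl⟩ := hφ
  have h := @Continuous.comp _ _ _ D.topology D.topology _ _ _
    (continuous_weakStar_apply D.toDual p) (D.continuous_mul_left b)
  exact D.mem_predual_of_continuous h

theorem DualBanachAlgebra.exists_comp_act_eq {φ : StrongDual ℂ A} (hφ : φ ∈ D.predual)
    (ξ : StrongDual ℂ (StrongDual ℂ A)) :
    ∃ b : A, (∀ ψ ∈ D.predual, ξ ψ = ψ b) ∧
      ξ.comp (act φ) = φ.comp (ContinuousLinearMap.mul ℂ A b) := by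
  obtain ⟨b, hb⟩ := D.exists_bidual_eq ξ
  refine ⟨b, hb, ?_⟩
  ext a
  exact hb _ (D.act_mem hφ a)

theorem DualBanachAlgebra.comp_act_mem {φ : StrongDual ℂ A} (hφ : φ ∈ D.predual)
    (ξ : StrongDual ℂ (StrongDual ℂ A)) : ξ.comp (act φ) ∈ D.predual := by
  obtain ⟨b, -, hb⟩ := D.exists_comp_act_eq hφ ξ
  rw [hb]
  exact D.comp_mul_mem hφ b

/-- If α and ξ restrict to the predual as evaluations at a and b, then α(ξ ∘ T) and ξ(a · φ) both
equal φ(b a), where T is `act φ`. -/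
theorem DualBanachAlgebra.isWeaklyCompact_act {φ : StrongDual ℂ A} (hφ : φ ∈ D.predual) :
    IsWeaklyCompact (act φ) := fun α => by
  obtain ⟨a, ha⟩ := D.exists_bidual_eq α
  refine ⟨act φ a, fun ξ => ?_⟩
  obtain ⟨b, hb, hξ⟩ := D.exists_comp_act_eq hφ ξ
  rw [ha _ (D.comp_act_mem hφ ξ), hξ, hb _ (D.act_mem hφ a)]
  rfl

end Predual

/-! ### Admissible norms -/

section AdmissibleNorm

variable {A : Type u} [NonUnitalNormedRing A] [NormedSpace ℂ A] [IsScalarTower ℂ A A]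
  [SMulCommClass ℂ A A]

theorem norm_act_apply_le (φ : StrongDual ℂ A) (a : A) : ‖act φ a‖ ≤ ‖a‖ * ‖φ‖ := by
  refine ContinuousLinearMap.opNorm_le_bound _ (by positivity) fun b => ?_
  calc ‖φ (b * a)‖ ≤ ‖φ‖ * (‖b‖ * ‖a‖) := φ.le_opNorm_of_le (norm_mul_le b a)
    _ = ‖a‖ * ‖φ‖ * ‖b‖ := by ring

theorem act_mul (φ : StrongDual ℂ A) (a b : A) : act φ (a * b) = act (act φ b) a := by
  ext c
  simp only [act_apply, mul_assoc]

/-- The module action `φ ↦ a · φ` on the dual of the algebra. -/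
def moduleAct (a : A) : StrongDual ℂ A →L[ℂ] StrongDual ℂ A :=
  transpose ((ContinuousLinearMap.mul ℂ A).flip a)

/-- Functionals of norm one in the predual have admissible norms. -/
theorem DualBanachAlgebra.exists_isAdmissibleNorm [CompleteSpace A] {P : Type*}
    [NormedAddCommGroup P] [NormedSpace ℂ P] (D : DualBanachAlgebra A P) {φ : StrongDual ℂ A}
    (hφ : φ ∈ D.predual) (hφ1 : ‖φ‖ = 1) : ∃ N : Seminorm ℂ (orbit φ), IsAdmissibleNorm φ N := by
  have hT : ‖act φ‖ ≤ 1 := ContinuousLinearMap.opNorm_le_bound _ zero_le_one fun a => by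
    simpa [hφ1] using norm_act_apply_le φ a
  obtain ⟨F, _, _, _, J, ι, h⟩ :=
    (D.isWeaklyCompact_act hφ).exists_isInterpolationSpace hT
  let j : orbit φ →ₗ[ℂ] F := J
  have hj : ∀ x : orbit φ, ι (j x) = x := h.apply_apply
  refine ⟨(normSeminorm ℂ F).comp j, ?_, ?_, ?_,
    F, inferInstance, inferInstance, inferInstance, j, ι, fun x => rfl, h.denseRange, hj,
    h.isReflexive, h.injective⟩
  · intro a b
    obtain ⟨S, hS, hιS⟩ := h.exists_lift (ContinuousLinearMap.mul ℂ A a) (moduleAct a) ‖a‖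
      (norm_nonneg a) (by ext1 b; exact act_mul φ a b) (ContinuousLinearMap.opNorm_mul_apply_le ℂ A a)
      (ContinuousLinearMap.opNorm_le_bound _ (norm_nonneg a) fun ψ => norm_act_apply_le ψ a)
    -- Injectivity of ι forces the abstract lift to be the expected action on the orbit.
    have h1 : S (j (toOrbit φ b)) = j (toOrbit φ (a * b)) := h.injective <| by
      rw [hιS, hj, hj]
      exact (act_mul φ a b).symm
    change ‖j (toOrbit φ (a * b))‖ ≤ ‖a‖ * ‖j (toOrbit φ b)‖
    rw [← h1]
    exact S.le_of_opNorm_le hS _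
  · intro a
    calc ‖act φ a‖ = ‖ι (j (toOrbit φ a))‖ := by rw [hj]; rfl
      _ ≤ ‖j (toOrbit φ a)‖ := h.norm_le _
  · intro a
    rw [hφ1, mul_one]
    exact h.norm_apply_le a

end AdmissibleNorm

/-! ### Representations with prescribed coefficients -/

section Coefficients

variable {A : Type*} [NonUnitalNormedRing A] [NormedSpace ℂ A]
  {E : Type*} [NormedAddCommGroup E] [NormedSpace ℂ E]

/-- A contractive homomorphism, as a bounded linear map. -/
def boundedRep (π : A →ₙₐ[ℂ] (E →L[ℂ] E)) (hπ : ∀ a, ‖π a‖ ≤ ‖a‖) : A →L[ℂ] (E →L[ℂ] E) :=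
  LinearMap.mkContinuous
    { toFun := π, map_add' := map_add π, map_smul' := map_smul π } 1
    fun a => (hπ a).trans_eq (one_mul _).symm

/-- The coefficient functional `a ↦ f (π(a) x)`. -/
def coefficient (π : A →ₙₐ[ℂ] (E →L[ℂ] E)) (hπ : ∀ a, ‖π a‖ ≤ ‖a‖) (f : StrongDual ℂ E) (x : E) :
    StrongDual ℂ A :=
  f.comp ((boundedRep π hπ).flip x)

@[simp]
theorem coefficient_apply (π : A →ₙₐ[ℂ] (E →L[ℂ] E)) (hπ : ∀ a, ‖π a‖ ≤ ‖a‖) (f : StrongDual ℂ E)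
    (x : E) (a : A) : coefficient π hπ f x a = f (π a x) := rfl

end Coefficients

/-! ### The predual of the bounded operators -/

section OperatorPairing

variable {E : Type*} [NormedAddCommGroup E] [NormedSpace ℂ E]

/-- Induction principle for closed subspaces defined by maps on the projective tensor product. -/
theorem apply_mem_of_tmul_mem {X Y V : Type*} [NormedAddCommGroup X] [NormedSpace ℂ X]
    [NormedAddCommGroup Y] [NormedSpace ℂ Y] [NormedAddCommGroup V] [NormedSpace ℂ V]
    {S : Submodule ℂ V} (hS : IsClosed (S : Set V)) (θ : ProjTensor X Y →L[ℂ] V)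
    (h : ∀ x y, θ (AlgTensor.tmul x y : AlgTensor X Y) ∈ S) (τ : ProjTensor X Y) : θ τ ∈ S := by
  let k : AlgTensor X Y → ProjTensor X Y := fun σ => σ
  refine UniformSpace.Completion.induction_on τ (hS.preimage θ.continuous) fun σ => ?_
  refine TensorProduct.induction_on (motive := fun σ => θ (k σ) ∈ S) σ ?_ h fun σ₁ σ₂ h₁ h₂ => ?_
  · have : θ (k 0) = 0 := by
      rw [show k 0 = 0 from UniformSpace.Completion.coe_zero, map_zero]
    exact this ▸ S.zero_mem
  · have : θ (k (σ₁ + σ₂)) = θ (k σ₁) + θ (k σ₂) := by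
      rw [← map_add]
      exact congrArg θ (UniformSpace.Completion.coe_add _ _)
    exact this ▸ S.add_mem h₁ h₂

theorem operatorPairing_tmul (T : E →L[ℂ] E) (f : StrongDual ℂ E) (x : E) :
    operatorPairing E T (AlgTensor.tmul f x : AlgTensor (StrongDual ℂ E) E) = f (T x) := by
  rw [operatorPairing_coe, algPairing_tmul]

/-- Functionals on the projective tensor product that agree on elementary tensors are equal. -/
theorem dual_projTensor_ext {X Y : Type*} [NormedAddCommGroup X] [NormedSpace ℂ X]
    [NormedAddCommGroup Y] [NormedSpace ℂ Y] {θ₁ θ₂ : StrongDual ℂ (ProjTensor X Y)}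
    (h : ∀ x y, θ₁ (AlgTensor.tmul x y : AlgTensor X Y) = θ₂ (AlgTensor.tmul x y : AlgTensor X Y)) :
    θ₁ = θ₂ := by
  ext τ
  have := apply_mem_of_tmul_mem (S := ⊥) (isClosed_singleton) (θ₁ - θ₂)
    (fun x y => by simp [h x y]) τ
  simpa [sub_eq_zero] using this

theorem norm_operatorPairing_le (T : E →L[ℂ] E) : ‖operatorPairing E T‖ ≤ ‖T‖ := by
  refine ContinuousLinearMap.opNorm_le_bound _ (norm_nonneg T) fun τ => ?_
  refine UniformSpace.Completion.induction_on τ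
    (isClosed_le (by fun_prop) (by fun_prop)) fun σ => ?_
  rw [operatorPairing_coe, UniformSpace.Completion.norm_coe]
  exact norm_algPairing_le T σ

theorem operatorPairing_injective {S T : E →L[ℂ] E}
    (h : ∀ τ, operatorPairing E S τ = operatorPairing E T τ) : S = T := by
  ext x
  refine (SeparatingDual.eq_iff_forall_dual_eq (R := ℂ)).2 fun f => ?_
  rw [← operatorPairing_tmul, h, operatorPairing_tmul]

variable (E) in
/-- The canonical duality, as a bounded linear map. -/
def operatorPairingL : (E →L[ℂ] E) →L[ℂ] StrongDual ℂ (ProjTensor (StrongDual ℂ E) E) :=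
  LinearMap.mkContinuous
    { toFun := operatorPairing E
      map_add' := fun S T => dual_projTensor_ext fun f x => by
        rw [_root_.add_apply]
        simp only [operatorPairing_tmul, _root_.add_apply, map_add]
      map_smul' := fun c T => dual_projTensor_ext fun f x => by
        rw [_root_.smul_apply]
        simp only [operatorPairing_tmul, _root_.smul_apply, map_smul, RingHom.id_apply] }
    1 fun T => (norm_operatorPairing_le T).trans_eq (one_mul _).symm

end OperatorPairing

/-! ### Weak-star closed representations -/

section Closed

variable {A P : Type*} [NonUnitalNormedRing A] [NormedSpace ℂ A]
  [NormedAddCommGroup P] [NormedSpace ℂ P] [CompleteSpace P] (D : DualBanachAlgebra A P)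
  {E : Type*} [NormedAddCommGroup E] [NormedSpace ℂ E]

/-- A contractive representation whose coefficients are in the predual, and every element of the
predual being a coefficient with the right norm, is isometric, weak-star continuous and has
weak-star closed range. -/
theorem DualBanachAlgebra.isometry_continuous_isClosed_range (π : A →ₙₐ[ℂ] (E →L[ℂ] E))
    (hπ : ∀ a, ‖π a‖ ≤ ‖a‖) (hmem : ∀ f x, coefficient π hπ f x ∈ D.predual)
    (hall : ∀ q : P, ∃ f x, ‖f‖ ≤ ‖q‖ ∧ ‖x‖ ≤ 1 ∧ coefficient π hπ f x = D.embed q) :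
    Isometry π ∧ Continuous[D.topology, operatorTopology E] π ∧
      IsClosed[operatorTopology E] (NonUnitalAlgHom.range π : Set (E →L[ℂ] E)) := by
  -- θ is the pre-adjoint of π; its values on elementary tensors are the coefficients of π.
  let θ : ProjTensor (StrongDual ℂ E) E →L[ℂ] StrongDual ℂ A :=
    ((operatorPairingL E).comp (boundedRep π hπ)).flip
  have hθ : ∀ τ a, θ τ a = operatorPairing E (π a) τ := fun τ a => rfl
  have hθt : ∀ f x, θ (AlgTensor.tmul f x : AlgTensor (StrongDual ℂ E) E) = coefficient π hπ f x :=
    fun f x => by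
      ext a
      rw [hθ, operatorPairing_tmul, coefficient_apply]
  have hθmem : ∀ τ, θ τ ∈ D.predual :=
    apply_mem_of_tmul_mem D.isClosed_predual θ fun f x => by rw [hθt]; exact hmem f x
  refine ⟨AddMonoidHomClass.isometry_of_norm π fun a => le_antisymm (hπ a) ?_, ?_, ?_⟩
  · rw [← D.toDual.norm_map a]
    refine ContinuousLinearMap.opNorm_le_bound _ (norm_nonneg _) fun q => ?_
    obtain ⟨f, x, hf, hx, hq⟩ := hall q
    rw [← D.embed_apply, ← hq, coefficient_apply, mul_comm]
    exact f.le_of_opNorm_le_of_le hf (by simpa using (π a).le_opNorm_of_le hx)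
  · refine continuous_weakStar_rng _ _ fun τ => ?_
    obtain ⟨q, hq⟩ := hθmem τ
    have : (fun a => operatorPairing E (π a) τ) = fun a => D.toDual a q := by
      ext a
      rw [← hθ, ← hq]
      rfl
    rw [this]
    exact continuous_weakStar_apply D.toDual q
  · have hset : (NonUnitalAlgHom.range π : Set (E →L[ℂ] E)) =
        ⋂ τ : {τ // θ τ = 0}, {T | operatorPairing E T τ = 0} := by
      ext T
      simp only [Set.mem_iInter, Set.mem_ofPred_eq, SetLike.mem_coe, NonUnitalAlgHom.mem_range]
      constructor
      · rintro ⟨a, rfl⟩ ⟨τ, hτ⟩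
        rw [← hθ, hτ]
        rfl
      · intro hT
        -- Modulo the kernel of θ, each τ is a single tensor f ⊗ x with ‖f‖ ≤ ‖θ τ‖ and ‖x‖ ≤ 1, and
        -- T ignores that kernel.
        have hdom : ∀ τ, ‖operatorPairing E T τ‖ ≤ ‖T‖ * ‖θ τ‖ := by
          intro τ
          obtain ⟨q, hq⟩ := hθmem τ
          replace hq : D.embed q = θ τ := hq
          obtain ⟨f, x, hf, hx, hfx⟩ := hall q
          have h0 : θ (τ - (AlgTensor.tmul f x : AlgTensor (StrongDual ℂ E) E)) = 0 := by
            rw [map_sub, hθt, hfx, hq, sub_self]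
          have h1 := hT ⟨_, h0⟩
          rw [map_sub, sub_eq_zero, operatorPairing_tmul] at h1
          rw [h1, ← hq, D.norm_embed, mul_comm]
          exact f.le_of_opNorm_le_of_le hf (by simpa using T.le_opNorm_of_le hx)
        -- So T factors through θ as a functional on A', whose restriction to the predual is a point
        -- b of A; then π(b) = T.
        obtain ⟨g, -, hg⟩ := exists_dual_comp_eq θ (operatorPairing E T) (norm_nonneg T) hdom
        obtain ⟨b, hb⟩ := D.exists_bidual_eq g
        refine ⟨b, operatorPairing_injective fun τ => ?_⟩
        rw [← hθ, ← hb _ (hθmem τ), ← hg]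
        rfl
    rw [hset]
    let := operatorTopology E
    exact isClosed_iInter fun τ =>
      isClosed_singleton.preimage (continuous_weakStar_apply (operatorPairing E) τ.1)

end Closed

/-! ### The representation attached to an element of the predual -/

section Local

/-- The Banach space underlying the unitization of `A`: the sum of `A` and `ℂ` with the norm
`‖a‖ + |λ|`. -/
def UnitSum (A : Type u) : Type u := WithLp 1 (A × ℂ)

namespace UnitSum

variable {A : Type u}

/-- The element `a + λ`. -/
def mk (a : A) (c : ℂ) : UnitSum A := WithLp.toLp 1 (a, c)

theorem exists_mk (z : UnitSum A) : ∃ a c, z = mk a c := ⟨WithLp.fst z, WithLp.snd z, rfl⟩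

variable [NonUnitalNormedRing A]

instance : NormedAddCommGroup (UnitSum A) := inferInstanceAs (NormedAddCommGroup (WithLp 1 (A × ℂ)))

instance [CompleteSpace A] : CompleteSpace (UnitSum A) :=
  inferInstanceAs (CompleteSpace (WithLp 1 (A × ℂ)))

theorem norm_mk (a : A) (c : ℂ) : ‖mk a c‖ = ‖a‖ + ‖c‖ := WithLp.prod_norm_eq_of_L1 (mk a c)

theorem mk_add (a b : A) (c d : ℂ) : mk a c + mk b d = mk (a + b) (c + d) := rfl

variable [NormedSpace ℂ A]

instance : NormedSpace ℂ (UnitSum A) := inferInstanceAs (NormedSpace ℂ (WithLp 1 (A × ℂ)))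

theorem smul_mk (k : ℂ) (a : A) (c : ℂ) : k • mk a c = mk (k • a) (k * c) := rfl

/-- The component in `A`. -/
def fst : UnitSum A →L[ℂ] A :=
  LinearMap.mkContinuous
    { toFun := fun z => WithLp.fst z, map_add' := fun _ _ => rfl, map_smul' := fun _ _ => rfl }
    1 fun z => by
      obtain ⟨a, c, rfl⟩ := z.exists_mk
      rw [norm_mk, one_mul]
      exact le_add_of_nonneg_right (norm_nonneg c)

/-- The scalar component. -/
def snd : StrongDual ℂ (UnitSum A) :=
  LinearMap.mkContinuous
    { toFun := fun z => WithLp.snd z, map_add' := fun _ _ => rfl, map_smul' := fun _ _ => rfl }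
    1 fun z => by
      obtain ⟨a, c, rfl⟩ := z.exists_mk
      rw [norm_mk, one_mul]
      exact le_add_of_nonneg_left (norm_nonneg a)

@[simp]
theorem fst_mk (a : A) (c : ℂ) : fst (mk a c) = a := rfl

@[simp]
theorem snd_mk (a : A) (c : ℂ) : snd (mk a c) = c := rfl

theorem norm_eq (z : UnitSum A) : ‖z‖ = ‖fst z‖ + ‖snd z‖ := by
  obtain ⟨a, c, rfl⟩ := z.exists_mk
  exact norm_mk a c

end UnitSum

variable {A : Type u} [NonUnitalNormedRing A] [NormedSpace ℂ A] [SMulCommClass ℂ A A]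

/-- Left multiplication by `a` on the unitization. -/
def extMul (a : A) : UnitSum A →L[ℂ] UnitSum A :=
  LinearMap.mkContinuous
    { toFun := fun z => UnitSum.mk (a * UnitSum.fst z + UnitSum.snd z • a) 0
      map_add' := fun z w => by
        rw [UnitSum.mk_add, map_add, map_add, mul_add, add_smul, add_zero, add_add_add_comm]
      map_smul' := fun c z => by
        rw [RingHom.id_apply, UnitSum.smul_mk, map_smul, map_smul, mul_smul_comm, smul_assoc,
          smul_add, mul_zero] }
    ‖a‖ fun z => by
      change ‖UnitSum.mk (a * UnitSum.fst z + UnitSum.snd z • a) 0‖ ≤ _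
      rw [UnitSum.norm_mk, norm_zero, add_zero, z.norm_eq, mul_add]
      exact norm_add_le_of_le (norm_mul_le _ _) ((norm_smul _ _).trans_le (mul_comm _ _).le)

theorem extMul_apply (a : A) (z : UnitSum A) :
    extMul a z = UnitSum.mk (a * UnitSum.fst z + UnitSum.snd z • a) 0 := rfl

theorem norm_extMul_le (a : A) : ‖extMul a‖ ≤ ‖a‖ :=
  LinearMap.mkContinuous_norm_le _ (norm_nonneg a) _

variable [IsScalarTower ℂ A A]

/-- The map `a + λ ↦ (a + λ) · φ` from the unitization of `A` to its dual, the dual being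
identified with the product of the dual of `A` and `ℂ`. -/
def extAct (φ : StrongDual ℂ A) : UnitSum A →L[ℂ] StrongDual ℂ A × ℂ :=
  (ContinuousLinearMap.inl ℂ (StrongDual ℂ A) ℂ).comp ((act φ).comp UnitSum.fst) +
    (UnitSum.snd : StrongDual ℂ (UnitSum A)).smulRight (φ, (0 : ℂ)) +
    (φ.comp UnitSum.fst).smulRight ((0 : StrongDual ℂ A), (1 : ℂ))

theorem extAct_apply (φ : StrongDual ℂ A) (z : UnitSum A) :
    extAct φ z = (act φ (UnitSum.fst z) + UnitSum.snd z • φ, φ (UnitSum.fst z)) := by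
  simp [extAct]

theorem norm_extAct_le {φ : StrongDual ℂ A} (hφ : ‖φ‖ ≤ 1) : ‖extAct φ‖ ≤ 1 := by
  refine ContinuousLinearMap.opNorm_le_bound _ zero_le_one fun z => ?_
  rw [extAct_apply, one_mul, z.norm_eq]
  refine max_le (norm_add_le_of_le ?_ ?_) ?_
  · exact (norm_act_apply_le φ _).trans (mul_le_of_le_one_right (norm_nonneg _) hφ)
  · rw [norm_smul]
    exact mul_le_of_le_one_right (norm_nonneg _) hφ
  · exact (φ.le_of_opNorm_le hφ _).trans (by simp)

/-- The action of `a` on the dual of the unitization. -/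
def extModuleAct (a : A) : StrongDual ℂ A × ℂ →L[ℂ] StrongDual ℂ A × ℂ :=
  LinearMap.mkContinuous
    { toFun := fun w => (moduleAct a w.1, w.1 a)
      map_add' := fun w w' => by simp
      map_smul' := fun c w => by simp }
    ‖a‖ fun w => by
      refine max_le ((norm_act_apply_le w.1 a).trans ?_) ((w.1.le_opNorm a).trans ?_)
      · exact mul_le_mul_of_nonneg_left (norm_fst_le w) (norm_nonneg a)
      · rw [mul_comm]
        exact mul_le_mul_of_nonneg_left (norm_fst_le w) (norm_nonneg a)

theorem extModuleAct_apply (a : A) (w : StrongDual ℂ A × ℂ) :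
    extModuleAct a w = (act w.1 a, w.1 a) := rfl

theorem norm_extModuleAct_le (a : A) : ‖extModuleAct a‖ ≤ ‖a‖ :=
  LinearMap.mkContinuous_norm_le _ (norm_nonneg a) _

/-- Associativity in the unitization: (a z) · φ = a · (z · φ). The second coordinate of the target
records the value at the adjoined unit. -/
theorem extAct_comp_extMul (φ : StrongDual ℂ A) (a : A) :
    (extAct φ).comp (extMul a) = (extModuleAct a).comp (extAct φ) := by
  ext1 z
  simp only [ContinuousLinearMap.comp_apply, extMul_apply, extAct_apply, extModuleAct_apply]
  refine Prod.ext ?_ ?_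
  · ext b
    simp [act_apply, mul_assoc]
  · simp [act_apply]

variable {P : Type*} [NormedAddCommGroup P] [NormedSpace ℂ P] (D : DualBanachAlgebra A P)

theorem DualBanachAlgebra.isWeaklyCompact_extAct {φ : StrongDual ℂ A} (hφ : φ ∈ D.predual) :
    IsWeaklyCompact (extAct φ) :=
  (((D.isWeaklyCompact_act hφ).comp_comp _ _).add (isWeaklyCompact_smulRight _ _)).add
    (isWeaklyCompact_smulRight _ _)

theorem dual_prod_apply {X : Type*} [NormedAddCommGroup X] [NormedSpace ℂ X]
    (ξ : StrongDual ℂ (X × ℂ)) (x : X) (c : ℂ) : ξ (x, c) = ξ (x, 0) + ξ (0, 1) * c := by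
  rw [mul_comm, ← smul_eq_mul, ← map_smul, ← map_add]
  simp

/-- Each element of the unit ball of the predual is a coefficient of a contractive representation
on a reflexive space, all of whose coefficients are in the predual. -/
theorem DualBanachAlgebra.exists_representation [CompleteSpace A] [CompleteSpace P]
    {φ : StrongDual ℂ A} (hφ : φ ∈ D.predual) (hφ1 : ‖φ‖ ≤ 1) :
    ∃ (F : Type u) (_ : NormedAddCommGroup F) (_ : NormedSpace ℂ F) (_ : CompleteSpace F)
      (ρ : A →ₙₐ[ℂ] (F →L[ℂ] F)) (hρ : ∀ a, ‖ρ a‖ ≤ ‖a‖), IsReflexive F ∧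
      (∀ f x, coefficient ρ hρ f x ∈ D.predual) ∧
      ∃ f x, ‖f‖ ≤ 1 ∧ ‖x‖ ≤ 1 ∧ coefficient ρ hρ f x = φ := by
  obtain ⟨F, _, _, _, J, ι, h⟩ :=
    IsWeaklyCompact.exists_isInterpolationSpace (Z := UnitSum A) (X := StrongDual ℂ A × ℂ)
      (T := extAct φ) (norm_extAct_le hφ1) (D.isWeaklyCompact_extAct hφ)
  choose S hS hιS using fun a : A => h.exists_lift (extMul a) (extModuleAct a) ‖a‖ (norm_nonneg a)
    (extAct_comp_extMul φ a) (norm_extMul_le a) (norm_extModuleAct_le a)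
  -- The lifts are chosen one at a time, but injectivity of ι determines them, so algebraic
  -- identities carry over from the module action.
  let ρ : A →ₙₐ[ℂ] (F →L[ℂ] F) :=
    { toFun := S
      map_smul' := fun c a => by
        ext y
        refine h.injective ?_
        simp [hιS, extModuleAct_apply]
      map_zero' := by
        ext y
        refine h.injective ?_
        simp [hιS, extModuleAct_apply]
      map_add' := fun a b => by
        ext y
        refine h.injective ?_
        simp [hιS, extModuleAct_apply]
      map_mul' := fun a b => by
        ext y
        refine h.injective ?_
        rw [mul_apply_eq_comp, hιS, hιS, hιS]
        simp only [extModuleAct_apply, act_mul, act_apply] }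
  have hιρ : ∀ a y, ι (ρ a y) = (act (ι y).1 a, (ι y).1 a) := hιS
  have hιJ : ∀ z, ι (J ⟨extAct φ z, z, rfl⟩) = extAct φ z := fun z => h.apply_apply _
  have hιmem : ∀ y, (ι y).1 ∈ D.predual := fun y => by
    refine h.denseRange.induction_on y (D.isClosed_predual.preimage
      (continuous_fst.comp ι.continuous)) ?_
    rintro ⟨_, z, rfl⟩
    change (ι (J ⟨extAct φ z, z, rfl⟩)).1 ∈ D.predual
    rw [hιJ, extAct_apply]
    exact D.predual.add_mem (D.act_mem hφ _) (D.predual.smul_mem _ hφ)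
  -- The vector comes from the adjoined unit, and the functional reads the value at that unit, so
  -- the coefficient at a is the value of a · φ there, namely φ(a).
  let z₀ : UnitSum A := UnitSum.mk 0 1
  have hz₀ : extAct φ z₀ = (φ, 0) := by simp [extAct_apply, z₀]
  refine ⟨F, inferInstance, inferInstance, inferInstance, ρ, hS, h.isReflexive, fun f x => ?_,
    (ContinuousLinearMap.snd ℂ (StrongDual ℂ A) ℂ).comp ι, J ⟨extAct φ z₀, z₀, rfl⟩, ?_, ?_, ?_⟩
  · refine h.isReflexive.apply_mem_of_comp_mem h.injective D.isClosed_predual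
      (transpose ((boundedRep ρ hS).flip x)) (fun ξ => ?_) f
    -- By reflexivity, functionals of the form ξ ∘ ι suffice; for these the coefficient splits along
    -- A' × ℂ into two terms, each in the predual.
    have : transpose ((boundedRep ρ hS).flip x) (ξ.comp ι) =
        (ξ.comp (ContinuousLinearMap.inl ℂ (StrongDual ℂ A) ℂ)).comp (act (ι x).1) +
          ξ ((0 : StrongDual ℂ A), (1 : ℂ)) • (ι x).1 := by
      ext a
      change ξ (ι (ρ a x)) = ξ (act (ι x).1 a, 0) + ξ (0, 1) * (ι x).1 a
      rw [hιρ]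
      exact dual_prod_apply ξ _ _
    rw [this]
    exact D.predual.add_mem (D.comp_act_mem (hιmem x) _) (D.predual.smul_mem _ (hιmem x))
  · exact ContinuousLinearMap.opNorm_le_bound _ zero_le_one fun y =>
      ((norm_snd_le (ι y)).trans (h.norm_le y)).trans_eq (one_mul _).symm
  · refine (h.norm_apply_le z₀).trans ?_
    simp [z₀, UnitSum.norm_mk]
  · ext a
    rw [coefficient_apply]
    change (ι (ρ a _)).2 = _
    rw [hιρ, hιJ, hz₀]

end Local

/-! ### The direct sum of representations -/

section DirectSum

variable {A : Type*} [NonUnitalNormedRing A] [NormedSpace ℂ A] {I : Type*} {F : I → Type*}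
  [∀ i, NormedAddCommGroup (F i)] [∀ i, NormedSpace ℂ (F i)]
  (ρ : ∀ i, A →ₙₐ[ℂ] (F i →L[ℂ] F i)) (hρ : ∀ i a, ‖ρ i a‖ ≤ ‖a‖)

/-- The direct sum of contractive representations, on the square-summable families. -/
def sumRep : A →ₙₐ[ℂ] (lp F 2 →L[ℂ] lp F 2) where
  toFun a := diagOp (norm_nonneg a) (fun i => ρ i a) fun i => hρ i a
  map_smul' c a := by ext x i; simp
  map_zero' := by ext x i; simp
  map_add' a b := by ext x i; simp
  map_mul' a b := by ext x i; simp

@[simp]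
theorem sumRep_apply (a : A) (x : lp F 2) (i : I) : sumRep ρ hρ a x i = ρ i a (x i) := rfl

theorem norm_sumRep_le (a : A) : ‖sumRep ρ hρ a‖ ≤ ‖a‖ :=
  norm_diagOp_le (norm_nonneg a) (fun i => ρ i a) fun i => hρ i a

theorem sumRep_single [DecidableEq I] (a : A) (i : I) (y : F i) :
    sumRep ρ hρ a (lp.single 2 i y) = lp.single 2 i (ρ i a y) := by
  ext j
  rw [sumRep_apply]
  by_cases h : j = i
  · subst h
    rw [lp.single_apply_self, lp.single_apply_self]
  · rw [lp.single_apply_ne _ _ _ h, lp.single_apply_ne _ _ _ h, map_zero]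

theorem coefficient_sumRep_single [DecidableEq I] (f : StrongDual ℂ (lp F 2)) (i : I) (y : F i) :
    coefficient (sumRep ρ hρ) (norm_sumRep_le ρ hρ) f (lp.single 2 i y) =
      coefficient (ρ i) (hρ i) (f.comp (lp.singleContinuousLinearMap ℂ F 2 i)) y := by
  ext a
  rw [coefficient_apply, sumRep_single]
  rfl

/-- Coefficients of a direct sum lie in any closed subspace containing those of the summands. -/
theorem coefficient_sumRep_mem {S : Submodule ℂ (StrongDual ℂ A)}
    (hS : IsClosed (S : Set (StrongDual ℂ A))) (h : ∀ i f x, coefficient (ρ i) (hρ i) f x ∈ S)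
    (f : StrongDual ℂ (lp F 2)) (x : lp F 2) :
    coefficient (sumRep ρ hρ) (norm_sumRep_le ρ hρ) f x ∈ S := by
  classical
  let c : lp F 2 →L[ℂ] StrongDual ℂ A :=
    (ContinuousLinearMap.compL ℂ A (lp F 2) ℂ f).comp
      (boundedRep (sumRep ρ hρ) (norm_sumRep_le ρ hρ)).flip
  have hx : HasSum (fun i => c (lp.single 2 i (x i))) (c x) :=
    c.hasSum (lp.hasSum_single (by simp) x)
  refine hS.mem_of_tendsto hx (Filter.Eventually.of_forall fun s => S.sum_mem fun i _ => ?_)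
  have hi : c (lp.single 2 i (x i)) = _ := coefficient_sumRep_single ρ hρ f i (x i)
  rw [hi]
  exact h i _ _

end DirectSum

/-- Every dual Banach algebra has an isometric, weak-star continuous representation with weak-star
closed range on a reflexive space. -/
theorem DualBanachAlgebra.exists_isometric_representation {A : Type u} {P : Type v}
    [NonUnitalNormedRing A] [NormedSpace ℂ A] [IsScalarTower ℂ A A] [SMulCommClass ℂ A A]
    [CompleteSpace A] [NormedAddCommGroup P] [NormedSpace ℂ P] [CompleteSpace P]
    (D : DualBanachAlgebra A P) :
    ∃ (E : Type u) (_ : NormedAddCommGroup E) (_ : NormedSpace ℂ E) (_ : CompleteSpace E),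
      IsReflexive E ∧ ∃ π : A →ₙₐ[ℂ] (E →L[ℂ] E), Isometry π ∧
        Continuous[D.topology, operatorTopology E] π ∧
        IsClosed[operatorTopology E] (NonUnitalAlgHom.range π : Set (E →L[ℂ] E)) := by
  classical
  -- Indexing by functionals on A instead of elements of P keeps the sum in the universe of A.
  let I : Type u := {φ : StrongDual ℂ A // φ ∈ D.predual ∧ ‖φ‖ ≤ 1}
  choose F _ _ _ ρ hρ hrefl hmem f₀ x₀ hf₀ hx₀ hφ using
    fun i : I => D.exists_representation i.2.1 i.2.2
  refine ⟨lp F 2, inferInstance, inferInstance, inferInstance, isReflexive_lp hrefl,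
    sumRep ρ hρ, D.isometry_continuous_isClosed_range _ (norm_sumRep_le ρ hρ)
      (coefficient_sumRep_mem ρ hρ D.isClosed_predual hmem) fun q => ?_⟩
  -- This includes q = 0, where the inverse is 0 by convention. The factor ‖q‖ is restored in the
  -- functional f, not in the vector.
  have hq : ‖((‖q‖ : ℂ)⁻¹ • q)‖ ≤ 1 := by
    rw [norm_smul, norm_inv, Complex.norm_real, norm_norm]
    exact inv_mul_le_one
  let i : I := ⟨D.embed ((‖q‖ : ℂ)⁻¹ • q), D.embed_mem _, (D.norm_embed _).trans_le hq⟩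
  refine ⟨(‖q‖ : ℂ) • (f₀ i).comp (lp.evalCLM ℂ F 2 i), lp.single 2 i (x₀ i), ?_, ?_, ?_⟩
  · rw [norm_smul, Complex.norm_real, norm_norm]
    refine mul_le_of_le_one_right (norm_nonneg q) ?_
    exact ContinuousLinearMap.opNorm_le_bound _ zero_le_one fun x =>
      (f₀ i).le_of_opNorm_le_of_le (hf₀ i) (lp.norm_apply_le_norm (by simp) x i)
  · rw [lp.norm_single (by simp)]
    exact hx₀ i
  · have h1 : ∀ a, f₀ i (ρ i a (x₀ i)) = (‖q‖ : ℂ)⁻¹ * D.embed q a := fun a => by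
      have := congrArg (fun ψ : StrongDual ℂ A => ψ a) (hφ i)
      simpa [i] using this
    ext a
    rw [coefficient_apply, sumRep_single]
    change (‖q‖ : ℂ) * f₀ i ((lp.single 2 i (ρ i a (x₀ i)) : lp F 2) i) = _
    rw [lp.single_apply_self, h1]
    by_cases hq0 : q = 0
    · simp [hq0]
    · rw [mul_inv_cancel_left₀]
      exact_mod_cast norm_ne_zero_iff.2 hq0

end DualBanach

end

theorem mainTheorem2 {A : Type u} {P : Type v}
    [NonUnitalNormedRing A] [NormedSpace ℂ A] [IsScalarTower ℂ A A] [SMulCommClass ℂ A A]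
    [CompleteSpace A] [NormedAddCommGroup P] [NormedSpace ℂ P] [CompleteSpace P]
    (D : DualBanach.DualBanachAlgebra A P) :
    ((∃ e : A, ∀ a : A, e * a = a ∧ a * e = a) →
      ∀ μ : P, ‖μ‖ = 1 →
        ∃ N : Seminorm ℂ (DualBanach.orbit (D.embed μ)),
          DualBanach.IsAdmissibleNorm (D.embed μ) N) ∧
    ∃ (E : Type u) (_ : NormedAddCommGroup E) (_ : NormedSpace ℂ E) (_ : CompleteSpace E),
      DualBanach.IsReflexive E ∧
      ∃ π : A →ₙₐ[ℂ] (E →L[ℂ] E),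
        Isometry π ∧
        @Continuous A (E →L[ℂ] E) D.topology (DualBanach.operatorTopology E) π ∧
        @IsClosed (E →L[ℂ] E) (DualBanach.operatorTopology E)
          (NonUnitalAlgHom.range π : Set (E →L[ℂ] E)) := by
  refine ⟨fun _ μ hμ => ?_, D.exists_isometric_representation⟩
  exact D.exists_isAdmissibleNorm (D.embed_mem μ) ((D.norm_embed μ).trans hμ)
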